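/- \textbf{Standard-form Hamiltonians.} Let $H=H_{trans}+H_{pen}+H_{in}+H_{out}$ act on an open chain of $n$ qudits $(\mathbb C^C\otimes\mathbb C^Q)^{\otimes n}=\mathcal H_C\otimes\mathcal H_Q$, each part being a sum of terms $h^{(i,i+1)}$ over the bonds $i=1,\dots,n-1$ (the terms may depend on the bond; translation-invariant Hamiltonians are a special case), where - $h_{trans}$ is a sum over transition rules $ab\to cd$ between pairs of clock basis symbols, at most one rule for each $(ab,cd)$, with a unitary $U_{abcd}$ on $\mathbb C^Q\otimes\mathbb C^Q$, of the terms $\tfrac12(|cd\rangle\otimes U_{abcd}-|ab\rangle)(\langle cd|\otimes U_{abcd}^\dagger-\langle ab|)$; - $h_{pen}=\sum_{ab\ \mathrm{illegal}}|ab\rangle\langle ab|\otimes 1$; - $h_{in}=\sum_{ab}|ab\rangle\langle ab|\otimes\Pi_{ab}$ and $h_{out}=|xy\rangle\langle xy|\otimes\Pi_{xy}$, all $\Pi$ being projectors onto spans of standard basis states of $\mathbb C^Q\otimes\mathbb C^Q$. A standard basis state of $\mathcal H_C$ (a clock state) is legal if it contains no illegal pair. Clock states are partitioned into blocks, the minimal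 sets closed under the transition rules. A legal evolution of length $T$ is a sequence of legal clock states $\gamma_0\to\gamma_1\to\dots\to\gamma_{T-1}$, consecutive ones being related by a transition rule, such that no rule applies backwards to $\gamma_0$ or forwards to $\gamma_{T-1}$; $U_t$ denotes the unitary on $\mathcal H_Q$ of the transition $\gamma_t\to\gamma_{t+1}$. \textbf{Standard-form clock.} Let $a,b,c>0$. $H$ has a standard-form clock of runtime $T$ (the number of clock states of a legal evolution) and initialisation time $T_{init}$, with constants $a,b,c$, if - some set of clock states contains all legal ones, is closed under the transition rules in both directions, and has at most one transition rule applying in each direction to each of its members; - a legal evolution of length $T$ exists, and every block consisting of legal states only is one; - on each legal evolution, $U_t=1$ for $t<T_{init}$; $H_{in}$ acts only at times $t\le T_{init}$; the pair $xy$ of $h_{out}$ occurs at exactly one bond of the last state and at no bond of the other states; - every legal state in a block with an illegal state reaches an illegal state, by forward transitions or by backward transitions, within $bn$ steps; - $T\ge an^2$ and $T_{init}\le cn$. \textbf{Encoding a verification.} A verification circuit (for an instance $x$) applies two-qubit gates to witness qubits and ancillas initialised to $|0\rangle$, and measures an output qubit. A family of polynomial-size verification circuits (not necessarily uniform) for a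 promise problem $(\mathrm{YES},\mathrm{NO})$ has error $\delta(x)$ if for $x\in\mathrm{YES}$ some witness is accepted with probability at least $1-\delta(x)$, and for $x\in\mathrm{NO}$ every witness is accepted with probability at most $\delta(x)$; a QMA verification has $\delta=1/3$. Its $k$-fold repetition runs $k$ copies in parallel on $k$ (possibly entangled) witness registers and accepts if more than half of the copies accept. $H$ encodes a verification procedure if, on every legal evolution, the correctly initialised inputs (the common kernel in $\mathcal H_Q$ of the input penalties along the evolution) are isometrically the states of the witness register together with unused registers, and the computation $U=U_{T-2}\cdots U_0$ followed by the projector $\Pi_{out}$ that $H_{out}$ applies at the last clock state rejects an input with the probability with which the procedure rejects the witness. \textbf{Theorem.} There is a universal constant $K>0$ such that for all $a,b,c>0$ there is $n_0$ with the following property. Let $p$ be any real-valued function of $n$ (in particular any polynomial) and let $H$ be a standard-form Hamiltonian on $n$ qudits having a standard-form clock of runtime $T$ with constants $a,b,c$, which encodes, for an instance $x$ of a promise problem, an amplified QMA verification, i.e. either (i) the $k$-fold repetition of a QMA verification (error $1/3$) with $k\ge K\,p(n)$, or (ii) a verification by a polynomial-size circuit family with error at most $e^{-2p(n)}$ on $x$.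 Then the ground state energy $\lambda_0(H)$ satisfies $$0\le\lambda_0(H)\le e^{-p(n)}\qquad\text{if } x\in\mathrm{YES},$$ $$1-\cos\Big(\frac{\pi}{2T}\Big)-e^{-p(n)}\le\lambda_0(H)\le 1-\cos\Big(\frac{\pi}{2T}\Big)\qquad\text{if } x\in\mathrm{NO},$$ where the lower bound in the NO case is claimed for $n\ge n_0$, and the other bounds for all $n$. -/

import Mathlib

open Matrix

/-! ### Vectors, local operators and ground state energy -/

/-- The squared Euclidean norm of a vector of amplitudes. -/
noncomputable def sqNorm {ι : Type*} [Fintype ι] (v : ι → ℂ) : ℝ := ∑ i, ‖v i‖ ^ 2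

open Classical in
/-- The operator on `(ℂ^α)^{⊗ ι}` that acts as `h` on the sites `i`, `j` (in this order) and as the
identity on all other sites.  The standard basis of `(ℂ^α)^{⊗ ι}` is `ι → α`. -/
noncomputable def onPair {ι α : Type*} (i j : ι) (h : Matrix (α × α) (α × α) ℂ) :
    Matrix (ι → α) (ι → α) ℂ :=
  Matrix.of fun x y =>
    if ∀ l, l ≠ i → l ≠ j → x l = y l then h (x i, x j) (y i, y j) else 0

/-- `E` is the ground state energy (the smallest eigenvalue) of `M`. -/
def IsGroundEnergy {ι : Type*} [Fintype ι] (M : Matrix ι ι ℂ) (E : ℝ) : Prop :=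
  IsLeast {e : ℝ | ∃ v : ι → ℂ, v ≠ 0 ∧ M *ᵥ v = (e : ℂ) • v} E

/-! ### QMA verification -/

/-- A gate: a unitary applied to two distinct qubits of a register. -/
structure Gate (ι : Type) where
  fst : ι
  snd : ι
  ne : fst ≠ snd
  unitary : Matrix.unitaryGroup (Fin 2 × Fin 2) ℂ

/-- A verification circuit: `wit` witness qubits, `anc` ancilla qubits that start in `|0⟩`, a list of
gates (the head of the list is applied first), and an output qubit; a final measurement of the
output qubit with result `1` means that the witness is accepted. (The instance is hard-wired into the
circuit.) -/
structure Verifier where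
  wit : ℕ
  anc : ℕ
  gates : List (Gate (Fin wit ⊕ Fin anc))
  out : Fin wit ⊕ Fin anc

namespace Verifier

/-- Basis states of the witness register. -/
abbrev Wit (V : Verifier) : Type := Fin V.wit → Fin 2

/-- Basis states of the whole register. -/
abbrev Reg (V : Verifier) : Type := Fin V.wit ⊕ Fin V.anc → Fin 2

/-- The unitary of the circuit. -/
noncomputable def circuit (V : Verifier) : Matrix V.Reg V.Reg ℂ :=
  V.gates.foldl (fun M g => onPair g.fst g.snd (g.unitary : Matrix _ _ ℂ) * M) 1

/-- The isometry which takes a witness `ψ` to the final state of the circuit on `ψ ⊗ |0…0⟩`. -/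
noncomputable def run (V : Verifier) : Matrix V.Reg V.Wit ℂ :=
  Matrix.of fun z w => V.circuit z (Sum.elim w fun _ => 0)

/-- The probability that the witness `ψ` is accepted. -/
noncomputable def acceptProb (V : Verifier) (ψ : V.Wit → ℂ) : ℝ :=
  ∑ z : V.Reg, if z V.out = 1 then ‖(V.run *ᵥ ψ) z‖ ^ 2 else 0

/-- The probability that the witness `ψ` is rejected. -/
noncomputable def rejectProb (V : Verifier) (ψ : V.Wit → ℂ) : ℝ :=
  ∑ z : V.Reg, if z V.out = 1 then 0 else ‖(V.run *ᵥ ψ) z‖ ^ 2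

/-- The isometry of `k` copies of the circuit which are run in parallel, each on its own witness
register and its own ancillas. -/
noncomputable def runPow (V : Verifier) (k : ℕ) :
    Matrix (Fin k → V.Reg) (Fin k → V.Wit) ℂ :=
  Matrix.of fun z w => ∏ j, V.run (z j) (w j)

/-- The `k`-fold repetition of the verification with a majority vote: the (possibly entangled)
`k`-register witness `Ψ` is accepted if more than half of the `k` output qubits are `1`; this is the
probability that it is rejected. -/
noncomputable def rejectProbPow (V : Verifier) (k : ℕ) (Ψ : (Fin k → V.Wit) → ℂ) : ℝ :=
  ∑ z : Fin k → V.Reg,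
    if k < 2 * (Finset.univ.filter fun j => z j V.out = 1).card then 0
    else ‖(V.runPow k *ᵥ Ψ) z‖ ^ 2

end Verifier

/-- `V` is a family of polynomial-size verification circuits for the promise problem `(yes, no)` with
error probability at most `δ x` on the instance `x`.  A QMA verification is the case `δ = 1/3`.
(The family need not be uniform, so that every QMA verification is included.) -/
structure IsQMAVerifier (V : List Bool → Verifier) (yes no : Set (List Bool))
    (δ : List Bool → ℝ) : Prop where
  witness_poly : ∃ q : Polynomial ℕ, ∀ x, (V x).wit ≤ q.eval x.length
  time_poly : ∃ p : Polynomial ℕ, ∀ x, (V x).anc + (V x).gates.length ≤ p.eval x.length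
  complete : ∀ x ∈ yes, ∃ ψ : (V x).Wit → ℂ, sqNorm ψ = 1 ∧ 1 - δ x ≤ (V x).acceptProb ψ
  sound : ∀ x ∈ no, ∀ ψ : (V x).Wit → ℂ, sqNorm ψ = 1 → (V x).acceptProb ψ ≤ δ x

/-! ### Standard-form Hamiltonians -/

/-- The nearest-neighbour bonds of an open chain of `n` sites. -/
abbrev Bond (n : ℕ) : Type := Fin (n - 1)

def Bond.left {n : ℕ} (b : Bond n) : Fin n := ⟨b.1, by have := b.2; omega⟩

def Bond.right {n : ℕ} (b : Bond n) : Fin n := ⟨b.1 + 1, by have := b.2; omega⟩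

/-- The pair of symbols that a standard basis state has on a bond. -/
def pairAt {n : ℕ} {α : Type*} (s : Fin n → α) (b : Bond n) : α × α := (s b.left, s b.right)

/-- The data of a standard-form Hamiltonian on `(ℂ^C ⊗ ℂ^Q)^{⊗ n}`.
The local terms may depend on the bond; in the translation-invariant case all fields are constant
in the bond. -/
structure StandardForm (n C Q : ℕ) where
  /-- The transition rule `ab → cd` on a bond with its unitary, or `none` if there is no transition
  from `ab` to `cd`. -/
  rule : Bond n → Fin C × Fin C → Fin C × Fin C →
    Option (Matrix.unitaryGroup (Fin Q × Fin Q) ℂ)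
  /-- The illegal pairs. -/
  illegal : Bond n → Set (Fin C × Fin C)
  /-- The projector `Π_ab` of the input penalty, as the set of basis states it projects onto. -/
  inProj : Bond n → Fin C × Fin C → Set (Fin Q × Fin Q)
  /-- The pair `xy` at which the output penalty acts. -/
  outPair : Bond n → Fin C × Fin C
  /-- The projector `Π_xy` of the output penalty, as the set of basis states it projects onto. -/
  outProj : Bond n → Set (Fin Q × Fin Q)

namespace StandardForm

variable {n C Q : ℕ}

/-- Standard basis states of the clock space `(ℂ^C)^{⊗ n}`. -/
abbrev Clock (n C : ℕ) : Type := Fin n → Fin C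

/-- Standard basis states of the computational space `(ℂ^Q)^{⊗ n}`. -/
abbrev Comp (n Q : ℕ) : Type := Fin n → Fin Q

/-- Standard basis states of two neighbouring sites, each of which is `ℂ^C ⊗ ℂ^Q`. -/
abbrev Two (C Q : ℕ) : Type := (Fin C × Fin Q) × (Fin C × Fin Q)

/-- The clock part of a basis state of two sites. -/
def Two.cl (p : Two C Q) : Fin C × Fin C := (p.1.1, p.2.1)

/-- The computational part of a basis state of two sites. -/
def Two.qu (p : Two C Q) : Fin Q × Fin Q := (p.1.2, p.2.2)

open Classical in
/-- The map `|cd⟩ ⊗ U - |ab⟩ ⊗ 1` from `ℂ^Q ⊗ ℂ^Q` to the space of two sites. -/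
noncomputable def ruleVec (ab cd : Fin C × Fin C)
    (U : Matrix.unitaryGroup (Fin Q × Fin Q) ℂ) : Matrix (Two C Q) (Fin Q × Fin Q) ℂ :=
  Matrix.of fun p r =>
    (if p.cl = cd then (U : Matrix _ _ ℂ) p.qu r else 0) -
      (if p.cl = ab then (1 : Matrix (Fin Q × Fin Q) (Fin Q × Fin Q) ℂ) p.qu r else 0)

/-- `h_trans`: the sum over all rules `ab → cd` of
`(1/2) (|cd⟩ ⊗ U - |ab⟩) (⟨cd| ⊗ U† - ⟨ab|)`. -/
noncomputable def hTrans (H : StandardForm n C Q) (b : Bond n) : Matrix (Two C Q) (Two C Q) ℂ :=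
  ∑ ab : Fin C × Fin C, ∑ cd : Fin C × Fin C,
    match H.rule b ab cd with
    | none => 0
    | some U => (1 / 2 : ℂ) • (ruleVec ab cd U * (ruleVec ab cd U)ᴴ)

open Classical in
/-- `h_pen`: the sum of `|ab⟩⟨ab| ⊗ 1` over the illegal pairs `ab`. -/
noncomputable def hPen (H : StandardForm n C Q) (b : Bond n) : Matrix (Two C Q) (Two C Q) ℂ :=
  Matrix.diagonal fun p => if p.cl ∈ H.illegal b then 1 else 0

open Classical in
/-- `h_in`: the sum of `|ab⟩⟨ab| ⊗ Π_ab` over all pairs `ab`. -/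
noncomputable def hIn (H : StandardForm n C Q) (b : Bond n) : Matrix (Two C Q) (Two C Q) ℂ :=
  Matrix.diagonal fun p => if p.qu ∈ H.inProj b p.cl then 1 else 0

open Classical in
/-- `h_out = |xy⟩⟨xy| ⊗ Π_xy`. -/
noncomputable def hOut (H : StandardForm n C Q) (b : Bond n) : Matrix (Two C Q) (Two C Q) ℂ :=
  Matrix.diagonal fun p => if p.cl = H.outPair b ∧ p.qu ∈ H.outProj b then 1 else 0

/-- The Hamiltonian `H_trans + H_pen + H_in + H_out` on `(ℂ^C ⊗ ℂ^Q)^{⊗ n}`. -/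
noncomputable def hamiltonian (H : StandardForm n C Q) :
    Matrix (Fin n → Fin C × Fin Q) (Fin n → Fin C × Fin Q) ℂ :=
  ∑ b : Bond n, onPair b.left b.right (H.hTrans b + H.hPen b + H.hIn b + H.hOut b)

/-! ### The clock -/

/-- A clock state is legal if it contains no illegal pair. -/
def Legal (H : StandardForm n C Q) (s : Clock n C) : Prop :=
  ∀ b, pairAt s b ∉ H.illegal b

/-- `s'` arises from `s` by one application of a transition rule. -/
def Step (H : StandardForm n C Q) (s s' : Clock n C) : Prop :=
  ∃ b : Bond n, (H.rule b (pairAt s b) (pairAt s' b)).isSome ∧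
    ∀ l, l ≠ b.left → l ≠ b.right → s l = s' l

/-- `s` and `s'` lie in the same block of the partition of the clock states into minimal subsets
which are closed under the transition rules. -/
def SameBlock (H : StandardForm n C Q) (s s' : Clock n C) : Prop :=
  Relation.EqvGen H.Step s s'

/-- A legal evolution with the `T` clock states `γ 0 → γ 1 → … → γ (T-1)`; no backwards transition
applies to the first one and no forwards transition applies to the last one. -/
structure IsRun (H : StandardForm n C Q) (T : ℕ) (γ : ℕ → Clock n C) : Prop where
  pos : 0 < T
  legal : ∀ t < T, H.Legal (γ t)
  step : ∀ t, t + 1 < T → H.Step (γ t) (γ (t + 1))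
  first : ∀ b ab, H.rule b ab (pairAt (γ 0) b) = none
  last : ∀ b cd, H.rule b (pairAt (γ (T - 1)) b) cd = none

open Classical in
/-- The unitary on `(ℂ^Q)^{⊗ n}` which belongs to the transition `s → s'`
(if just one rule takes `s` to `s'`; in general the sum over the rules that do). -/
noncomputable def stepOp (H : StandardForm n C Q) (s s' : Clock n C) :
    Matrix (Comp n Q) (Comp n Q) ℂ :=
  ∑ b : Bond n,
    if ∀ l, l ≠ b.left → l ≠ b.right → s l = s' l then
      match H.rule b (pairAt s b) (pairAt s' b) with
      | none => 0
      | some U => onPair b.left b.right (U : Matrix _ _ ℂ)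
    else 0

/-- The computation performed along `γ` up to time `t`: `U_{t-1} ⋯ U_1 U_0`. -/
noncomputable def evolve (H : StandardForm n C Q) (γ : ℕ → Clock n C) :
    ℕ → Matrix (Comp n Q) (Comp n Q) ℂ
  | 0 => 1
  | t + 1 => H.stepOp (γ t) (γ (t + 1)) * H.evolve γ t

open Classical in
/-- The operator on `(ℂ^Q)^{⊗ n}` by which `H_in` acts at the clock state `s`. -/
noncomputable def inOp (H : StandardForm n C Q) (s : Clock n C) :
    Matrix (Comp n Q) (Comp n Q) ℂ :=
  ∑ b : Bond n, onPair b.left b.right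
    (Matrix.diagonal fun q => if q ∈ H.inProj b (pairAt s b) then 1 else 0)

open Classical in
/-- The operator on `(ℂ^Q)^{⊗ n}` by which `H_out` acts at the clock state `s`. -/
noncomputable def outOp (H : StandardForm n C Q) (s : Clock n C) :
    Matrix (Comp n Q) (Comp n Q) ℂ :=
  ∑ b : Bond n, onPair b.left b.right
    (Matrix.diagonal fun q => if pairAt s b = H.outPair b ∧ q ∈ H.outProj b then 1 else 0)

/-- The probability `⟨φ| U† Π_out U |φ⟩` that the computation along `γ` rejects the input `φ`. -/
noncomputable def rejectProb (H : StandardForm n C Q) (T : ℕ) (γ : ℕ → Clock n C)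
    (φ : Comp n Q → ℂ) : ℝ :=
  (star (H.evolve γ (T - 1) *ᵥ φ) ⬝ᵥ (H.outOp (γ (T - 1)) *ᵥ (H.evolve γ (T - 1) *ᵥ φ))).re

/-- `H` has a standard-form clock of runtime `T` and initialisation time `Tinit`; `a`, `b`, `c` are
the constants in `T = Ω(n²)`, in "within `O(n)` transitions" and in `Tinit = O(n)`. -/
structure IsStandardClock (H : StandardForm n C Q) (a b c : ℝ) (T Tinit : ℕ) : Prop where
  /-- There is a set `W` of clock states that contains all legal ones, is closed under the transition
  rules (in both directions), and to whose members at most one transition rule applies in each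
  direction. -/
  single : ∃ W : Set (Clock n C), (∀ s, H.Legal s → s ∈ W) ∧
    (∀ s s', H.Step s s' → (s ∈ W ↔ s' ∈ W)) ∧
    (∀ s ∈ W, ∀ i cd j cd', (H.rule i (pairAt s i) cd).isSome →
      (H.rule j (pairAt s j) cd').isSome → i = j ∧ cd = cd') ∧
    (∀ s ∈ W, ∀ i ab j ab', (H.rule i ab (pairAt s i)).isSome →
      (H.rule j ab' (pairAt s j)).isSome → i = j ∧ ab = ab')
  /-- There is a legal evolution. -/
  exists_run : ∃ γ, H.IsRun T γ
  /-- Every block that contains only legal states is a legal evolution with `T` clock states. -/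
  legal_block : ∀ s, (∀ s', H.SameBlock s s' → H.Legal s') → ∃ γ, H.IsRun T γ ∧ ∃ t < T, γ t = s
  /-- The computation is trivial during the initialisation. -/
  init_trivial : ∀ γ, H.IsRun T γ → ∀ t, t + 1 < T → t < Tinit → H.stepOp (γ t) (γ (t + 1)) = 1
  /-- `H_in` acts only during the initialisation. -/
  in_init : ∀ γ, H.IsRun T γ → ∀ t < T, ∀ i, (H.inProj i (pairAt (γ t) i)).Nonempty → t ≤ Tinit
  /-- `∑_i |xy⟩⟨xy|_{i,i+1}` detects the final state of a legal evolution: it is `1` on the final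
  state and `0` on the other ones. -/
  final_detect : ∀ γ, H.IsRun T γ → ∀ t < T,
    {i : Bond n | pairAt (γ t) i = H.outPair i}.ncard = if t + 1 = T then 1 else 0
  /-- A legal state in a block with an illegal state evolves, forwards or backwards, to an illegal
  state within `b n` transitions. -/
  evolve_illegal : ∀ s s', H.Legal s → H.SameBlock s s' → ¬ H.Legal s' →
    ∃ (f : ℕ → Clock n C) (m : ℕ), (m : ℝ) ≤ b * n ∧ f 0 = s ∧ ¬ H.Legal (f m) ∧
      ((∀ j < m, H.Step (f j) (f (j + 1))) ∨ (∀ j < m, H.Step (f (j + 1)) (f j)))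
  runtime : a * (n : ℝ) ^ 2 ≤ T
  init_time : (Tinit : ℝ) ≤ c * n

/-- `H` (with a clock of runtime `T`) encodes a verification procedure with witness space `ℂ^ι` which
rejects a witness `ψ` with probability `rej ψ`: on every legal evolution, the correctly initialised
inputs (the common kernel of the input penalties) are, through an isometry `J`, the states of the
witness register together with unused registers (of total dimension `m`), and the computation
rejects an input with the probability with which the procedure rejects the witness. -/
def Encodes (H : StandardForm n C Q) (T : ℕ) {ι : Type} [Fintype ι] [DecidableEq ι]
    (rej : (ι → ℂ) → ℝ) : Prop :=
  ∀ γ, H.IsRun T γ → ∃ (m : ℕ) (J : Matrix (Comp n Q) (ι × Fin m) ℂ), 0 < m ∧ Jᴴ * J = 1 ∧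
    (∀ φ : Comp n Q → ℂ, (∀ t < T, H.inOp (γ t) *ᵥ φ = 0) ↔ ∃ ψ, J *ᵥ ψ = φ) ∧
    ∀ ψ : ι × Fin m → ℂ, H.rejectProb T γ (J *ᵥ ψ) = ∑ y, rej fun w => ψ (w, y)

end StandardForm

/-!
The Hamiltonian is a sum of positive terms. Written in components `v = ∑ s, |s⟩ ⊗ v_s` over the
clock states, its expectation value is a sum of energies attributed to the clock states
(`StandardForm.quadForm_hamiltonian`), in which a transition `s → s'` with unitary `U` contributes
`½ |v_{s'} - U v_s|²`. So the clock states split into chains of transitions that do not interact.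

On a legal evolution, undoing the unitaries turns the energy into that of a path with `T` sites
whose hopping terms act alike on all basis states of the computational space, with penalties for
wrong inputs at the beginning and with the rejection probability as penalty at the last site
(`StandardForm.IsRun.sum_stateEnergy`). A path with a unit penalty at an end has the ground state
energy `E₀ = 1 - cos (π / (2T))`, with ground state `cos ((t + 1/2) π / (2T))`; comparison with this
positive function (Picone's inequality, `PathChain.hop_sub_ge`) gives the lower bound. A unit penalty
at another site in the first part of the path costs at least as much
(`PathChain.energy_ge_of_penalty_at`).

Upper bounds come from history states (`StandardForm.IsRun.exists_history`): with equal amplitudes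
on an accepted input, the energy is the rejection probability divided by `T`; with the amplitudes of
the path ground state, it is at most `E₀` on any input.

For the lower bound on a NO instance, the input penalties are diagonal, so basis states are either
correctly initialised or penalised by one unit at some early site. The rejection projector can have
coherences between these two kinds, but as correct inputs are accepted with probability at most
`ε²`, they cost at most `ε` (`StandardForm.IsRun.rejectProb_ge`), which leaves `E₀ - ε` for each
basis state (`StandardForm.IsRun.sum_stateEnergy_ge`). Every clock state outside the legal evolutions
is illegal or reaches an illegal one within `O(n)` transitions. As transitions are injective, a given
clock state lies on only `O(n)` of these paths; hence the energy there is `Ω(n⁻²)`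
(`StandardForm.sum_rest_sqNorm_le`), which exceeds `E₀ = O(T⁻²) = O(n⁻⁴)` for large `n`.

The error of the `k`-fold repetition is bounded by an exponential moment: weighting each wrong
outcome by `2` multiplies the squared norm by at most `4/3` per copy, a bound that passes to tensor
powers and so covers entangled witnesses (`sqNorm_tensorPow_mulVec_le`), while a wrong majority has
weight at least `√2 ^ k`.
-/

/-! ### Two-site operators -/

/-- The configuration `x` with the symbols at the sites `i`, `j` replaced by those of `p`. -/
def pairUpd {ι α : Type*} [DecidableEq ι] (i j : ι) (x : ι → α) (p : α × α) : ι → α :=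
  Function.update (Function.update x j p.2) i p.1

section PairUpd

variable {ι α : Type*} [DecidableEq ι] {i j : ι}

@[simp] lemma pairUpd_fst (x : ι → α) (p : α × α) : pairUpd i j x p i = p.1 := by
  simp [pairUpd]

lemma pairUpd_snd (hij : i ≠ j) (x : ι → α) (p : α × α) : pairUpd i j x p j = p.2 := by
  simp [pairUpd, hij.symm]

lemma pairUpd_of_ne (x : ι → α) (p : α × α) {l : ι} (h1 : l ≠ i) (h2 : l ≠ j) :
    pairUpd i j x p l = x l := by
  simp [pairUpd, h1, h2]

lemma pairUpd_eq_of_agree {x y : ι → α} (h : ∀ l, l ≠ i → l ≠ j → x l = y l) :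
    pairUpd i j x (y i, y j) = y := by
  funext l
  by_cases h1 : l = i
  · subst h1; simp
  · by_cases h2 : l = j
    · subst h2; simp [pairUpd, h1]
    · rw [pairUpd_of_ne _ _ h1 h2, h l h1 h2]

lemma pairUpd_pairUpd (hij : i ≠ j) (x : ι → α) (p p' : α × α) :
    pairUpd i j (pairUpd i j x p) p' = pairUpd i j x p' := by
  funext l
  by_cases h1 : l = i
  · subst h1; simp
  · by_cases h2 : l = j
    · subst h2; simp [pairUpd_snd hij]
    · simp [pairUpd_of_ne _ _ h1 h2]

open Classical in
lemma sum_agree [Fintype ι] [Fintype α] {R : Type*} [AddCommMonoid R] (hij : i ≠ j)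
    (x : ι → α) (g : (ι → α) → R) :
    (∑ y, if ∀ l, l ≠ i → l ≠ j → x l = y l then g y else 0) = ∑ p, g (pairUpd i j x p) := by
  rw [← Finset.sum_filter]
  refine Finset.sum_bij' (fun y _ => (y i, y j)) (fun p _ => pairUpd i j x p) ?_ ?_ ?_ ?_ ?_
  · simp
  · intro p _
    simp only [Finset.mem_filter, Finset.mem_univ, true_and]
    exact fun l h1 h2 => (pairUpd_of_ne x p h1 h2).symm
  · intro y hy
    simp only [Finset.mem_filter, Finset.mem_univ, true_and] at hy
    exact pairUpd_eq_of_agree hy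
  · intro p _
    simp [pairUpd_snd hij]
  · intro y hy
    simp only [Finset.mem_filter, Finset.mem_univ, true_and] at hy
    rw [pairUpd_eq_of_agree hy]

/-- Every configuration arises from `card (α × α)` configurations by resetting two sites. -/
lemma sum_sum_pairUpd [Fintype ι] [Fintype α] {R : Type*} [Semiring R] (hij : i ≠ j)
    (g : (ι → α) → R) :
    ∑ x, ∑ p, g (pairUpd i j x p) = (Fintype.card (α × α) : R) * ∑ x, g x := by
  classical
  simp_rw [← sum_agree hij]
  rw [Finset.sum_comm, Finset.mul_sum]
  refine Finset.sum_congr rfl fun y _ => ?_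
  have h := sum_agree hij y (fun _ => g y)
  rw [Finset.sum_const, Finset.card_univ, nsmul_eq_mul] at h
  rw [← h]
  exact Finset.sum_congr rfl fun x _ => by simp only [eq_comm]

end PairUpd

section OnPair

variable {ι α : Type*} {i j : ι}

lemma onPair_add (h h' : Matrix (α × α) (α × α) ℂ) :
    onPair i j (h + h') = onPair i j h + onPair i j h' := by
  ext x y
  simp only [onPair, Matrix.of_apply, Matrix.add_apply]
  split_ifs <;> simp

lemma onPair_zero : onPair i j (0 : Matrix (α × α) (α × α) ℂ) = 0 := by
  ext x y
  simp [onPair]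

lemma onPair_sum {κ : Type*} (S : Finset κ) (h : κ → Matrix (α × α) (α × α) ℂ) :
    onPair i j (∑ k ∈ S, h k) = ∑ k ∈ S, onPair i j (h k) := by
  classical
  induction S using Finset.induction_on with
  | empty => simp [onPair_zero]
  | insert a S ha ih => rw [Finset.sum_insert ha, Finset.sum_insert ha, onPair_add, ih]

lemma onPair_conjTranspose (h : Matrix (α × α) (α × α) ℂ) :
    (onPair i j h)ᴴ = onPair i j hᴴ := by
  ext x y
  simp only [onPair, Matrix.of_apply, Matrix.conjTranspose_apply]
  by_cases hh : ∀ l, l ≠ i → l ≠ j → x l = y l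
  · rw [if_pos hh, if_pos fun l h1 h2 => (hh l h1 h2).symm]
  · rw [if_neg hh, if_neg fun h' => hh fun l h1 h2 => (h' l h1 h2).symm, star_zero]

lemma onPair_diagonal [DecidableEq α] [DecidableEq (ι → α)] (d : α × α → ℂ) :
    onPair i j (Matrix.diagonal d) = Matrix.diagonal fun x : ι → α => d (x i, x j) := by
  ext x y
  simp only [onPair, Matrix.of_apply, Matrix.diagonal_apply]
  by_cases hxy : x = y
  · subst hxy; simp
  · rw [if_neg hxy]
    split_ifs with h1 h2
    · exact absurd (funext fun l => by
        by_cases hi : l = i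
        · subst hi; exact congrArg Prod.fst h2
        · by_cases hj : l = j
          · subst hj; exact congrArg Prod.snd h2
          · exact h1 l hi hj) hxy
    · rfl
    · rfl

lemma onPair_one [DecidableEq α] [DecidableEq (ι → α)] :
    onPair i j (1 : Matrix (α × α) (α × α) ℂ) = (1 : Matrix (ι → α) (ι → α) ℂ) := by
  rw [← Matrix.diagonal_one, onPair_diagonal, ← Matrix.diagonal_one]

variable [Fintype ι] [Fintype α]

lemma onPair_mulVec [DecidableEq ι] (hij : i ≠ j) (h : Matrix (α × α) (α × α) ℂ)
    (v : (ι → α) → ℂ) (x : ι → α) :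
    (onPair i j h *ᵥ v) x = ∑ p, h (x i, x j) p * v (pairUpd i j x p) := by
  have := sum_agree hij x (fun y => h (x i, x j) (y i, y j) * v y)
  simp only [pairUpd_fst, pairUpd_snd hij] at this
  rw [← this]
  simp only [Matrix.mulVec, dotProduct, onPair, Matrix.of_apply, ite_mul, zero_mul]
  exact Finset.sum_congr rfl fun y _ => by congr

lemma onPair_mul [DecidableEq ι] (hij : i ≠ j) (h h' : Matrix (α × α) (α × α) ℂ) :
    onPair i j h * onPair i j h' = onPair i j (h * h') := by
  classical
  refine Matrix.ext_of_mulVec_single fun y => ?_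
  funext x
  rw [← Matrix.mulVec_mulVec, onPair_mulVec hij, onPair_mulVec hij]
  simp only [onPair_mulVec hij, pairUpd_fst, pairUpd_snd hij, pairUpd_pairUpd hij,
    Matrix.mul_apply, Finset.mul_sum, Finset.sum_mul]
  rw [Finset.sum_comm]
  simp only [mul_assoc]

lemma onPair_unitary [DecidableEq ι] [DecidableEq α] (hij : i ≠ j)
    (U : Matrix.unitaryGroup (α × α) ℂ) :
    (onPair i j (U : Matrix (α × α) (α × α) ℂ))ᴴ * onPair i j (U : Matrix (α × α) (α × α) ℂ) =
      1 := by
  rw [onPair_conjTranspose, onPair_mul hij, ← Matrix.star_eq_conjTranspose,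
    Matrix.UnitaryGroup.star_mul_self, onPair_one]

end OnPair

/-! ### Squared norms and quadratic forms -/

section SqNorm

variable {ι κ : Type*} [Fintype ι] [Fintype κ]

/-- The (real part of the) expectation value `⟨v|M|v⟩`. -/
noncomputable def quadForm (M : Matrix ι ι ℂ) (v : ι → ℂ) : ℝ := (star v ⬝ᵥ (M *ᵥ v)).re

lemma sqNorm_nonneg (v : ι → ℂ) : 0 ≤ sqNorm v := Finset.sum_nonneg fun _ _ => sq_nonneg _

@[simp] lemma sqNorm_zero : sqNorm (0 : ι → ℂ) = 0 := by simp [sqNorm]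

lemma sqNorm_pos {v : ι → ℂ} (hv : v ≠ 0) : 0 < sqNorm v := by
  obtain ⟨i, hi⟩ := Function.ne_iff.mp hv
  exact Finset.sum_pos' (fun _ _ => sq_nonneg _) ⟨i, Finset.mem_univ _, by
    have : 0 < ‖v i‖ := norm_pos_iff.mpr hi
    positivity⟩

lemma sqNorm_smul (c : ℂ) (v : ι → ℂ) : sqNorm (c • v) = ‖c‖ ^ 2 * sqNorm v := by
  simp [sqNorm, mul_pow, Finset.mul_sum]

lemma sqNorm_eq_dotProduct (v : ι → ℂ) : (sqNorm v : ℂ) = star v ⬝ᵥ v := by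
  simp only [sqNorm, dotProduct, Pi.star_apply, RCLike.star_def, Complex.conj_mul']
  push_cast
  rfl

lemma sqNorm_eq_norm (v : ι → ℂ) : sqNorm v = ‖(WithLp.toLp 2 v : EuclideanSpace ℂ ι)‖ ^ 2 := by
  rw [EuclideanSpace.norm_sq_eq]; rfl

lemma sqNorm_mulVec_of_isometry [DecidableEq ι] {M : Matrix κ ι ℂ} (hM : Mᴴ * M = 1)
    (v : ι → ℂ) : sqNorm (M *ᵥ v) = sqNorm v := by
  have : (sqNorm (M *ᵥ v) : ℂ) = sqNorm v := by
    rw [sqNorm_eq_dotProduct, sqNorm_eq_dotProduct, Matrix.star_mulVec, Matrix.dotProduct_mulVec,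
      Matrix.vecMul_vecMul, hM, Matrix.vecMul_one]
  exact_mod_cast this

lemma quadForm_add (M N : Matrix ι ι ℂ) (v : ι → ℂ) :
    quadForm (M + N) v = quadForm M v + quadForm N v := by
  simp [quadForm, Matrix.add_mulVec]

lemma quadForm_sum {κ : Type*} (S : Finset κ) (M : κ → Matrix ι ι ℂ) (v : ι → ℂ) :
    quadForm (∑ k ∈ S, M k) v = ∑ k ∈ S, quadForm (M k) v := by
  simp [quadForm, Matrix.sum_mulVec, dotProduct_sum]

lemma quadForm_diagonal [DecidableEq ι] (d : ι → ℝ) (v : ι → ℂ) :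
    quadForm (Matrix.diagonal fun i => (d i : ℂ)) v = ∑ i, d i * ‖v i‖ ^ 2 := by
  simp only [quadForm, dotProduct, Matrix.mulVec_diagonal, Pi.star_apply, RCLike.star_def,
    Complex.re_sum]
  refine Finset.sum_congr rfl fun i _ => ?_
  rw [mul_left_comm, Complex.conj_mul', ← Complex.ofReal_pow, ← Complex.ofReal_mul,
    Complex.ofReal_re]

lemma quadForm_mul_conjTranspose (B : Matrix ι κ ℂ) (v : ι → ℂ) :
    quadForm (B * Bᴴ) v = sqNorm (Bᴴ *ᵥ v) := by
  have : (sqNorm (Bᴴ *ᵥ v) : ℂ) = star v ⬝ᵥ ((B * Bᴴ) *ᵥ v) := by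
    rw [sqNorm_eq_dotProduct, Matrix.star_mulVec, Matrix.conjTranspose_conjTranspose,
      ← Matrix.mulVec_mulVec, ← Matrix.dotProduct_mulVec]
  rw [quadForm, ← this, Complex.ofReal_re]

/-- The expectation value of a two-site operator is the average, over the configurations of all
sites, of the expectation values of its matrix on the two sites. -/
lemma card_mul_quadForm_onPair {α : Type*} [Fintype α] [DecidableEq ι] {i j : ι} (hij : i ≠ j)
    (h : Matrix (α × α) (α × α) ℂ) (v : (ι → α) → ℂ) :
    (Fintype.card (α × α) : ℝ) * quadForm (onPair i j h) v =
      ∑ x, quadForm h fun p => v (pairUpd i j x p) := by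
  have key := sum_sum_pairUpd hij fun x => star (v x) * (onPair i j h *ᵥ v) x
  simp only [onPair_mulVec hij, pairUpd_fst, pairUpd_snd hij, pairUpd_pairUpd hij] at key
  have h2 : quadForm (onPair i j h) v =
      (∑ x, star (v x) * ∑ p, h (x i, x j) p * v (pairUpd i j x p)).re := by
    simp only [quadForm, dotProduct, onPair_mulVec hij, Pi.star_apply]
  rw [h2, ← Complex.re_ofReal_mul, Complex.ofReal_natCast, ← key, Complex.re_sum]
  rfl

end SqNorm

/-! ### The energy of a state as a sum over clock states -/

lemma Bond.left_ne_right {n : ℕ} (b : Bond n) : b.left ≠ b.right := by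
  intro h
  have := congrArg Fin.val h
  simp [Bond.left, Bond.right] at this

namespace StandardForm

variable {n C Q : ℕ}

/-- The component `v_s` of `v = ∑ s, |s⟩ ⊗ v_s` at the clock state `s`. -/
def block (v : (Fin n → Fin C × Fin Q) → ℂ) (s : Clock n C) : Comp n Q → ℂ :=
  fun q => v fun i => (s i, q i)

/-- The state `∑ s, |s⟩ ⊗ u s`. -/
def assemble (u : Clock n C → Comp n Q → ℂ) : (Fin n → Fin C × Fin Q) → ℂ :=
  fun x => u (fun i => (x i).1) fun i => (x i).2

@[simp] lemma block_assemble (u : Clock n C → Comp n Q → ℂ) (s : Clock n C) :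
    block (assemble u) s = u s := rfl

lemma sum_clock_comp {R : Type*} [AddCommMonoid R] (f : (Fin n → Fin C × Fin Q) → R) :
    ∑ x, f x = ∑ s : Clock n C, ∑ q : Comp n Q, f fun i => (s i, q i) := by
  rw [← Fintype.sum_prod_type' (f := fun (s : Clock n C) (q : Comp n Q) => f fun i => (s i, q i))]
  exact Fintype.sum_equiv (Equiv.arrowProdEquivProdArrow _ (fun _ => Fin C) (fun _ => Fin Q)) _ _
    fun x => rfl

lemma sqNorm_eq_sum_block (v : (Fin n → Fin C × Fin Q) → ℂ) :
    sqNorm v = ∑ s, sqNorm (block v s) := by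
  rw [sqNorm, sum_clock_comp]
  rfl

/-- The clock state `s` with the symbols on the bond `b` replaced by `cd`. -/
def updBond (b : Bond n) (s : Clock n C) (cd : Fin C × Fin C) : Clock n C :=
  pairUpd b.left b.right s cd

lemma pairAt_updBond (b : Bond n) (s : Clock n C) (cd : Fin C × Fin C) :
    pairAt (updBond b s cd) b = cd := by
  simp [pairAt, updBond, pairUpd_snd b.left_ne_right]

lemma updBond_agree (b : Bond n) (s : Clock n C) (cd : Fin C × Fin C) (l : Fin n)
    (h1 : l ≠ b.left) (h2 : l ≠ b.right) : s l = updBond b s cd l :=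
  (pairUpd_of_ne s cd h1 h2).symm

lemma updBond_pairAt {b : Bond n} {s s' : Clock n C}
    (h : ∀ l, l ≠ b.left → l ≠ b.right → s l = s' l) : updBond b s (pairAt s' b) = s' :=
  pairUpd_eq_of_agree h

/-- The energy of the transition rules that apply forwards to the clock state `s`. -/
noncomputable def transEnergy (H : StandardForm n C Q) (v : (Fin n → Fin C × Fin Q) → ℂ)
    (s : Clock n C) : ℝ :=
  ∑ b : Bond n, ∑ cd : Fin C × Fin C,
    match H.rule b (pairAt s b) cd with
    | none => 0
    | some U => 1 / 2 * sqNorm (block v (updBond b s cd) -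
        onPair b.left b.right (U : Matrix _ _ ℂ) *ᵥ block v s)

open Classical in
/-- The energy of the illegal pairs in the clock state `s`. -/
noncomputable def penEnergy (H : StandardForm n C Q) (v : (Fin n → Fin C × Fin Q) → ℂ)
    (s : Clock n C) : ℝ :=
  ∑ b : Bond n, if pairAt s b ∈ H.illegal b then sqNorm (block v s) else 0

/-- The energy that is attributed to the clock state `s`. A transition counts for the clock state
that it leaves. -/
noncomputable def stateEnergy (H : StandardForm n C Q) (v : (Fin n → Fin C × Fin Q) → ℂ)
    (s : Clock n C) : ℝ :=
  H.transEnergy v s + H.penEnergy v s + quadForm (H.inOp s) (block v s) +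
    quadForm (H.outOp s) (block v s)

/-- The two-site vector of a rule acts as `|cd⟩ ⊗ U - |ab⟩`; its expectation value is the squared
mismatch between the `cd` component and the image of the `ab` component. -/
lemma quadForm_ruleVec (ab cd : Fin C × Fin C) (U : Matrix.unitaryGroup (Fin Q × Fin Q) ℂ)
    (u : Two C Q → ℂ) :
    quadForm (ruleVec ab cd U * (ruleVec ab cd U)ᴴ) u =
      sqNorm ((fun r : Fin Q × Fin Q => u ((cd.1, r.1), (cd.2, r.2))) -
        (U : Matrix _ _ ℂ) *ᵥ fun r : Fin Q × Fin Q => u ((ab.1, r.1), (ab.2, r.2))) := by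
  classical
  rw [quadForm_mul_conjTranspose]
  set f := fun r : Fin Q × Fin Q => u ((cd.1, r.1), (cd.2, r.2)) with hf
  set g := fun r : Fin Q × Fin Q => u ((ab.1, r.1), (ab.2, r.2)) with hg
  have hU : (U : Matrix (Fin Q × Fin Q) (Fin Q × Fin Q) ℂ)ᴴ * (U : Matrix _ _ ℂ) = 1 := by
    rw [← Matrix.star_eq_conjTranspose]; exact Matrix.UnitaryGroup.star_mul_self U
  have hU' : (U : Matrix (Fin Q × Fin Q) (Fin Q × Fin Q) ℂ) * (U : Matrix _ _ ℂ)ᴴ = 1 :=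
    mul_eq_one_comm.mp hU
  -- a sum over two sites with fixed clock part is a sum over the computational part
  have hsum : ∀ (ab : Fin C × Fin C) (F : Two C Q → ℂ),
      (∑ p : Two C Q, if p.cl = ab then F p else 0) =
        ∑ r : Fin Q × Fin Q, F ((ab.1, r.1), (ab.2, r.2)) := by
    intro ab F
    rw [← Finset.sum_filter]
    refine Finset.sum_bij' (fun p _ => p.qu) (fun r _ => ((ab.1, r.1), (ab.2, r.2)))
      ?_ ?_ ?_ ?_ ?_
    · simp
    · exact fun r _ => Finset.mem_filter.mpr ⟨Finset.mem_univ _, rfl⟩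
    · rintro ⟨⟨x1, x2⟩, ⟨x3, x4⟩⟩ h
      replace h : (x1, x3) = ab := (Finset.mem_filter.mp h).2
      subst h; rfl
    · simp [Two.qu]
    · rintro ⟨⟨x1, x2⟩, ⟨x3, x4⟩⟩ h
      replace h : (x1, x3) = ab := (Finset.mem_filter.mp h).2
      subst h; rfl
  have h1 : (ruleVec ab cd U)ᴴ *ᵥ u = (U : Matrix _ _ ℂ)ᴴ *ᵥ f - g := by
    funext r
    have e : ∀ p : Two C Q, (ruleVec ab cd U)ᴴ r p * u p =
        (if p.cl = cd then star ((U : Matrix _ _ ℂ) p.qu r) * u p else 0) -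
          (if p.cl = ab then
            (1 : Matrix (Fin Q × Fin Q) (Fin Q × Fin Q) ℂ) r p.qu * u p else 0) := by
      intro p
      simp only [ruleVec, Matrix.conjTranspose_apply, Matrix.of_apply, star_sub, sub_mul]
      congr 1
      · split_ifs <;> simp
      · split_ifs
        · rw [← Matrix.conjTranspose_apply, Matrix.conjTranspose_one]
        · simp
    have e2 : ((1 : Matrix (Fin Q × Fin Q) (Fin Q × Fin Q) ℂ) *ᵥ g) r = g r := by
      rw [Matrix.one_mulVec]
    rw [Pi.sub_apply, ← e2]
    simp only [Matrix.mulVec, dotProduct, e, Finset.sum_sub_distrib, hsum]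
    rfl
  rw [h1]
  have h2 : (U : Matrix _ _ ℂ) *ᵥ ((U : Matrix _ _ ℂ)ᴴ *ᵥ f - g) = f - (U : Matrix _ _ ℂ) *ᵥ g := by
    rw [Matrix.mulVec_sub, Matrix.mulVec_mulVec, hU', Matrix.one_mulVec]
  rw [← h2, sqNorm_mulVec_of_isometry hU]

lemma quadForm_smul_half {ι : Type*} [Fintype ι] (M : Matrix ι ι ℂ) (v : ι → ℂ) :
    quadForm ((1 / 2 : ℂ) • M) v = 1 / 2 * quadForm M v := by
  have : (1 / 2 : ℂ) = ((1 / 2 : ℝ) : ℂ) := by push_cast; rfl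
  rw [this, quadForm, quadForm, Matrix.smul_mulVec, dotProduct_smul, smul_eq_mul,
    Complex.re_ofReal_mul]

open Classical in
lemma quadForm_onPair_rule (b : Bond n) (ab cd : Fin C × Fin C)
    (U : Matrix.unitaryGroup (Fin Q × Fin Q) ℂ) (v : (Fin n → Fin C × Fin Q) → ℂ) :
    quadForm (onPair b.left b.right (ruleVec ab cd U * (ruleVec ab cd U)ᴴ)) v =
      ∑ s : Clock n C, if pairAt s b = ab then
        sqNorm (block v (updBond b s cd) - onPair b.left b.right (U : Matrix _ _ ℂ) *ᵥ block v s)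
      else 0 := by
  classical
  have hne := b.left_ne_right
  -- without basis states both sides are empty sums
  rcases isEmpty_or_nonempty (Fin n → Fin C × Fin Q) with hE | ⟨⟨x0⟩⟩
  · have : ∀ s : Clock n C, ∀ w : Comp n Q → ℂ, sqNorm w = 0 := by
      intro s w
      refine Finset.sum_eq_zero fun q _ => ?_
      exact (hE.false fun i => (s i, q i)).elim
    simp only [quadForm, dotProduct]
    rw [Finset.univ_eq_empty, Finset.sum_empty, Complex.zero_re]
    exact (Finset.sum_eq_zero fun s _ => by simp [this s]).symm
  have hK : (Fintype.card ((Fin C × Fin Q) × (Fin C × Fin Q)) : ℝ) ≠ 0 := by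
    have : Nonempty ((Fin C × Fin Q) × (Fin C × Fin Q)) := ⟨(x0 b.left, x0 b.left)⟩
    exact_mod_cast Fintype.card_ne_zero
  refine mul_left_cancel₀ hK ?_
  rw [card_mul_quadForm_onPair hne]
  let F : (Fin n → Fin C × Fin Q) → ℝ := fun x =>
    if pairAt (fun i => (x i).1) b = ab then
      ‖(block v (updBond b (fun i => (x i).1) cd) -
        onPair b.left b.right (U : Matrix _ _ ℂ) *ᵥ block v fun i => (x i).1) fun i => (x i).2‖ ^ 2
    else 0
  have hF : (∑ s : Clock n C, if pairAt s b = ab then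
        sqNorm (block v (updBond b s cd) - onPair b.left b.right (U : Matrix _ _ ℂ) *ᵥ block v s)
      else 0) = ∑ x, F x := by
    rw [sum_clock_comp]
    refine Finset.sum_congr rfl fun s _ => ?_
    simp only [F]
    split_ifs
    · rfl
    · simp
  rw [hF, ← sum_sum_pairUpd hne F]
  refine Finset.sum_congr rfl fun x _ => ?_
  rw [quadForm_ruleVec]
  -- only the pairs with clock part `ab` contribute
  have hs : ∀ G : (Fin C × Fin Q) × (Fin C × Fin Q) → ℝ, (∀ p, (p.1.1, p.2.1) ≠ ab → G p = 0) →
      ∑ p, G p = ∑ r : Fin Q × Fin Q, G ((ab.1, r.1), (ab.2, r.2)) := by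
    intro G hG
    symm
    refine Finset.sum_of_injOn (fun r : Fin Q × Fin Q => ((ab.1, r.1), (ab.2, r.2)))
      ?_ ?_ ?_ ?_
    · intro r _ r' _ h
      simp only [Prod.mk.injEq, true_and] at h
      exact Prod.ext h.1 h.2
    · simp
    · rintro ⟨⟨x1, x2⟩, ⟨x3, x4⟩⟩ _ h
      refine hG _ fun h' => h ⟨(x2, x4), by simp, ?_⟩
      rw [← h']
    · intro r _; rfl
  have hcl : ∀ p : (Fin C × Fin Q) × (Fin C × Fin Q),
      (fun i => (pairUpd b.left b.right x p i).1) =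
        updBond b (fun i => (x i).1) (p.1.1, p.2.1) := by
    intro p; funext i
    by_cases h1 : i = b.left
    · subst h1; simp [updBond]
    · by_cases h2 : i = b.right
      · subst h2; simp [updBond, pairUpd_snd hne]
      · simp [updBond, pairUpd_of_ne _ _ h1 h2]
  have hqu : ∀ p : (Fin C × Fin Q) × (Fin C × Fin Q),
      (fun i => (pairUpd b.left b.right x p i).2) =
        pairUpd b.left b.right (fun i => (x i).2) (p.1.2, p.2.2) := by
    intro p; funext i
    by_cases h1 : i = b.left
    · subst h1; simp
    · by_cases h2 : i = b.right
      · subst h2; simp [pairUpd_snd hne]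
      · simp [pairUpd_of_ne _ _ h1 h2]
  have hblock : ∀ (ab : Fin C × Fin C) (r : Fin Q × Fin Q),
      block v (updBond b (fun i => (x i).1) ab) (pairUpd b.left b.right (fun i => (x i).2) r) =
        v (pairUpd b.left b.right x ((ab.1, r.1), (ab.2, r.2))) := by
    intro ab r
    unfold block
    rw [← hcl ((ab.1, r.1), (ab.2, r.2)), ← hqu ((ab.1, r.1), (ab.2, r.2))]
  rw [hs]
  · refine Finset.sum_congr rfl fun r _ => ?_
    simp only [F, hcl, hqu, pairAt_updBond, if_true]
    rw [Pi.sub_apply, Pi.sub_apply, onPair_mulVec hne, pairUpd_fst, pairUpd_snd hne]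
    have : updBond b (updBond b (fun i => (x i).1) ab) cd = updBond b (fun i => (x i).1) cd :=
      pairUpd_pairUpd hne _ _ _
    rw [this, hblock]
    simp only [pairUpd_pairUpd hne, hblock]
    rfl
  · intro p hp
    simp only [F, hcl, pairAt_updBond]
    rw [if_neg hp]

lemma quadForm_onPair_hTrans (H : StandardForm n C Q) (b : Bond n)
    (v : (Fin n → Fin C × Fin Q) → ℂ) :
    quadForm (onPair b.left b.right (H.hTrans b)) v = ∑ s : Clock n C, ∑ cd : Fin C × Fin C,
      match H.rule b (pairAt s b) cd with
      | none => 0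
      | some U => 1 / 2 * sqNorm (block v (updBond b s cd) -
          onPair b.left b.right (U : Matrix _ _ ℂ) *ᵥ block v s) := by
  classical
  simp only [hTrans, onPair_sum, quadForm_sum]
  rw [Finset.sum_comm, Finset.sum_comm (s := (Finset.univ : Finset (Clock n C)))]
  refine Finset.sum_congr rfl fun cd _ => ?_
  have h1 : ∀ ab : Fin C × Fin C, quadForm (onPair b.left b.right
      (match H.rule b ab cd with
        | none => 0
        | some U => (1 / 2 : ℂ) • (ruleVec ab cd U * (ruleVec ab cd U)ᴴ))) v =
      ∑ s : Clock n C, if pairAt s b = ab then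
        (match H.rule b ab cd with
        | none => 0
        | some U => 1 / 2 * sqNorm (block v (updBond b s cd) -
          onPair b.left b.right (U : Matrix _ _ ℂ) *ᵥ block v s)) else 0 := by
    intro ab
    cases hr : H.rule b ab cd with
    | none => simp [onPair_zero, quadForm]
    | some U =>
      simp only
      have : onPair b.left b.right ((1 / 2 : ℂ) • (ruleVec ab cd U * (ruleVec ab cd U)ᴴ)) =
          (1 / 2 : ℂ) • onPair b.left b.right (ruleVec ab cd U * (ruleVec ab cd U)ᴴ) := by
        ext x y
        simp only [onPair, Matrix.of_apply, Matrix.smul_apply]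
        split_ifs <;> simp
      rw [this, quadForm_smul_half, quadForm_onPair_rule, Finset.mul_sum]
      refine Finset.sum_congr rfl fun s _ => ?_
      split_ifs <;> simp
  refine (Finset.sum_congr rfl fun ab _ => h1 ab).trans ?_
  rw [Finset.sum_comm]
  refine Finset.sum_congr rfl fun s _ => ?_
  rw [Finset.sum_ite_eq]
  simp

open Classical in
lemma quadForm_inOp (H : StandardForm n C Q) (s : Clock n C) (w : Comp n Q → ℂ) :
    quadForm (H.inOp s) w = ∑ b : Bond n, ∑ q : Comp n Q,
      (if pairAt q b ∈ H.inProj b (pairAt s b) then 1 else 0) * ‖w q‖ ^ 2 := by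
  rw [inOp, quadForm_sum]
  refine Finset.sum_congr rfl fun b _ => ?_
  rw [← quadForm_diagonal, onPair_diagonal]
  simp only [apply_ite Complex.ofReal, Complex.ofReal_one, Complex.ofReal_zero]
  rfl

open Classical in
lemma quadForm_outOp (H : StandardForm n C Q) (s : Clock n C) (w : Comp n Q → ℂ) :
    quadForm (H.outOp s) w = ∑ b : Bond n, ∑ q : Comp n Q,
      (if pairAt s b = H.outPair b ∧ pairAt q b ∈ H.outProj b then 1 else 0) * ‖w q‖ ^ 2 := by
  rw [outOp, quadForm_sum]
  refine Finset.sum_congr rfl fun b _ => ?_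
  rw [← quadForm_diagonal, onPair_diagonal]
  simp only [apply_ite Complex.ofReal, Complex.ofReal_one, Complex.ofReal_zero]
  rfl

/-- The energy of a state is the sum of the energies attributed to the clock states. -/
theorem quadForm_hamiltonian (H : StandardForm n C Q) (v : (Fin n → Fin C × Fin Q) → ℂ) :
    quadForm H.hamiltonian v = ∑ s, H.stateEnergy v s := by
  classical
  have hdiag : ∀ (b : Bond n) (P : Two C Q → Prop) [DecidablePred P],
      quadForm (onPair b.left b.right (Matrix.diagonal fun p : (Fin C × Fin Q) × (Fin C × Fin Q) =>
        if P p then (1 : ℂ) else 0)) v =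
      ∑ s : Clock n C, ∑ q : Comp n Q,
        (if P ((s b.left, q b.left), (s b.right, q b.right)) then 1 else 0) * ‖block v s q‖ ^ 2 := by
    intro b P _
    rw [onPair_diagonal]
    have := quadForm_diagonal
      (fun x : Fin n → Fin C × Fin Q => if P (x b.left, x b.right) then (1 : ℝ) else 0) v
    simp only [apply_ite Complex.ofReal, Complex.ofReal_one, Complex.ofReal_zero] at this
    rw [this, sum_clock_comp]
    rfl
  simp only [hamiltonian, quadForm_sum, onPair_add, quadForm_add, quadForm_onPair_hTrans,
    stateEnergy, Finset.sum_add_distrib, transEnergy, penEnergy, quadForm_inOp, quadForm_outOp]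
  congr 1
  · congr 1
    · congr 1
      · exact Finset.sum_comm
      rw [Finset.sum_comm]
      refine Finset.sum_congr rfl fun b _ => ?_
      rw [hPen, hdiag]
      refine Finset.sum_congr rfl fun s _ => ?_
      have e : ∀ q : Comp n Q, Two.cl ((s b.left, q b.left), s b.right, q b.right) = pairAt s b :=
        fun q => rfl
      simp only [e]
      split_ifs <;> simp [sqNorm]
    · rw [Finset.sum_comm]
      refine Finset.sum_congr rfl fun b _ => ?_
      rw [hIn, hdiag]
      rfl
  · rw [Finset.sum_comm]
    refine Finset.sum_congr rfl fun b _ => ?_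
    rw [hOut, hdiag b fun p => p.cl = H.outPair b ∧ p.qu ∈ H.outProj b]
    rfl

lemma transEnergy_nonneg (H : StandardForm n C Q) (v : (Fin n → Fin C × Fin Q) → ℂ)
    (s : Clock n C) : 0 ≤ H.transEnergy v s := by
  refine Finset.sum_nonneg fun b _ => Finset.sum_nonneg fun cd _ => ?_
  split
  · exact le_rfl
  · exact mul_nonneg (by norm_num) (sqNorm_nonneg _)

lemma penEnergy_nonneg (H : StandardForm n C Q) (v : (Fin n → Fin C × Fin Q) → ℂ)
    (s : Clock n C) : 0 ≤ H.penEnergy v s := by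
  classical
  refine Finset.sum_nonneg fun b _ => ?_
  split_ifs
  · exact sqNorm_nonneg _
  · exact le_rfl

lemma quadForm_inOp_nonneg (H : StandardForm n C Q) (s : Clock n C) (w : Comp n Q → ℂ) :
    0 ≤ quadForm (H.inOp s) w := by
  rw [quadForm_inOp]
  refine Finset.sum_nonneg fun b _ => Finset.sum_nonneg fun q _ => ?_
  split_ifs <;> positivity

lemma quadForm_outOp_nonneg (H : StandardForm n C Q) (s : Clock n C) (w : Comp n Q → ℂ) :
    0 ≤ quadForm (H.outOp s) w := by
  rw [quadForm_outOp]
  refine Finset.sum_nonneg fun b _ => Finset.sum_nonneg fun q _ => ?_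
  split_ifs <;> positivity

lemma transEnergy_le_stateEnergy (H : StandardForm n C Q) (v : (Fin n → Fin C × Fin Q) → ℂ)
    (s : Clock n C) : H.transEnergy v s ≤ H.stateEnergy v s := by
  have h1 := H.penEnergy_nonneg v s
  have h2 := H.quadForm_inOp_nonneg s (block v s)
  have h3 := H.quadForm_outOp_nonneg s (block v s)
  unfold stateEnergy
  linarith

lemma stateEnergy_nonneg (H : StandardForm n C Q) (v : (Fin n → Fin C × Fin Q) → ℂ)
    (s : Clock n C) : 0 ≤ H.stateEnergy v s :=
  (H.transEnergy_nonneg v s).trans (H.transEnergy_le_stateEnergy v s)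

lemma sqNorm_le_stateEnergy_of_not_legal {H : StandardForm n C Q}
    (v : (Fin n → Fin C × Fin Q) → ℂ) {s : Clock n C} (hs : ¬ H.Legal s) :
    sqNorm (block v s) ≤ H.stateEnergy v s := by
  classical
  have h1 := H.transEnergy_nonneg v s
  have h2 := H.quadForm_inOp_nonneg s (block v s)
  have h3 := H.quadForm_outOp_nonneg s (block v s)
  have h4 : sqNorm (block v s) ≤ H.penEnergy v s := by
    simp only [Legal, not_forall, not_not] at hs
    obtain ⟨b, hb⟩ := hs
    refine le_trans (le_of_eq (if_pos hb).symm) (Finset.single_le_sum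
      (f := fun b => if pairAt s b ∈ H.illegal b then sqNorm (block v s) else 0)
      (fun b _ => ?_) (Finset.mem_univ b))
    split_ifs
    · exact sqNorm_nonneg _
    · exact le_rfl
  unfold stateEnergy
  linarith

lemma penEnergy_of_legal {H : StandardForm n C Q} (v : (Fin n → Fin C × Fin Q) → ℂ)
    {s : Clock n C} (hs : H.Legal s) : H.penEnergy v s = 0 :=
  Finset.sum_eq_zero fun b _ => if_neg (hs b)

end StandardForm

/-! ### Path Laplacians with a unit penalty at one site -/

namespace PathChain

/-- The energy `½ ∑_{t<k} |u (t+1) - u t|²` of the hopping terms on the sites `0, …, k`. -/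
noncomputable def hop (u : ℕ → ℂ) (k : ℕ) : ℝ :=
  ∑ t ∈ Finset.range k, 1 / 2 * ‖u (t + 1) - u t‖ ^ 2

lemma hop_nonneg (u : ℕ → ℂ) (k : ℕ) : 0 ≤ hop u k :=
  Finset.sum_nonneg fun _ _ => by positivity

/-- The zero-slope solution `cos ((t + 1/2) θ)` of the eigenvalue equation on the half line
(indexed by real numbers, to have values at `t = -1` too). -/
noncomputable def wave (θ t : ℝ) : ℝ := Real.cos ((t + 1 / 2) * θ)

lemma wave_add_wave (θ t : ℝ) : wave θ (t - 1) + wave θ (t + 1) = 2 * Real.cos θ * wave θ t := by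
  unfold wave
  rw [show (t - 1 + 1 / 2) * θ = (t + 1 / 2) * θ - θ by ring,
    show (t + 1 + 1 / 2) * θ = (t + 1 / 2) * θ + θ by ring, Real.cos_sub, Real.cos_add]
  ring

lemma wave_neg_one (θ : ℝ) : wave θ (0 - 1) = wave θ 0 := by
  unfold wave
  rw [show ((0 : ℝ) - 1 + 1 / 2) * θ = -((0 + 1 / 2) * θ) by ring, Real.cos_neg]

/-- Picone's inequality on an edge with positive comparison values `α`, `β` at its ends. -/
lemma norm_sub_sq_ge (z w : ℂ) {α β : ℝ} (hα : 0 < α) (hβ : 0 < β) :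
    ‖w‖ ^ 2 * (1 - α / β) + ‖z‖ ^ 2 * (1 - β / α) ≤ ‖w - z‖ ^ 2 := by
  have h1 : (‖w‖ - ‖z‖) ^ 2 ≤ ‖w - z‖ ^ 2 := by
    rw [← sq_abs (‖w‖ - ‖z‖)]
    exact pow_le_pow_left₀ (abs_nonneg _) (abs_norm_sub_norm_le w z) 2
  have h2 : 0 ≤ (‖w‖ * α - ‖z‖ * β) ^ 2 / (α * β) := by positivity
  have h3 : (‖w‖ * α - ‖z‖ * β) ^ 2 / (α * β) =
      ‖w‖ ^ 2 * (α / β) + ‖z‖ ^ 2 * (β / α) - 2 * ‖w‖ * ‖z‖ := by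
    field_simp
    ring
  nlinarith

/-- The ground state representation: as long as the zero-slope solution is positive, the energy
density `1 - cos θ` can be stripped off all sites but the last, at the price of a boundary term. -/
lemma hop_sub_ge (u : ℕ → ℂ) (θ : ℝ) (k : ℕ) (hpos : ∀ t : ℕ, t ≤ k → 0 < wave θ t) :
    1 / 2 * (1 - wave θ (k - 1) / wave θ k) * ‖u k‖ ^ 2 ≤
      hop u k - (1 - Real.cos θ) * ∑ t ∈ Finset.range k, ‖u t‖ ^ 2 := by
  induction k with
  | zero =>
    have := hpos 0 le_rfl
    have h0 := wave_neg_one θ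
    simp only [Nat.cast_zero] at *
    rw [h0, div_self this.ne']
    simp [hop]
  | succ k ih =>
    have h1 := ih fun t ht => hpos t (ht.trans (Nat.le_succ k))
    have hk := hpos k (Nat.le_succ k)
    have hk' := hpos (k + 1) le_rfl
    have h2 := norm_sub_sq_ge (u k) (u (k + 1)) hk hk'
    have h3 : wave θ (k - 1) / wave θ k + wave θ ((k + 1 : ℕ) : ℝ) / wave θ k = 2 * Real.cos θ := by
      rw [← add_div, Nat.cast_succ, wave_add_wave, mul_div_assoc, div_self hk.ne', mul_one]
    simp only [hop, Finset.sum_range_succ] at h1 ⊢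
    have h4 : wave θ (((k + 1 : ℕ) : ℝ) - 1) = wave θ k := by push_cast; congr 1; ring
    rw [h4]
    have h5 : wave θ (k - 1) / wave θ k = 2 * Real.cos θ - wave θ ((k + 1 : ℕ) : ℝ) / wave θ k := by
      linarith
    rw [h5] at h1
    nlinarith

/-- The chain cut at the site `k`, with the right part read backwards. -/
lemma hop_reverse (u : ℕ → ℂ) (T k : ℕ) (hk : k ≤ T) :
    hop u T = hop u k + hop (fun t => u (T - t)) (T - k) := by
  have h := Finset.sum_range_add_sum_Ico (fun t => 1 / 2 * ‖u (t + 1) - u t‖ ^ 2) hk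
  unfold hop
  rw [← h]
  congr 1
  rw [Finset.sum_Ico_eq_sum_range, ← Finset.sum_range_reflect]
  refine Finset.sum_congr rfl fun t ht => ?_
  rw [Finset.mem_range] at ht
  rw [show k + (T - k - 1 - t) + 1 = T - t by omega, show k + (T - k - 1 - t) = T - (t + 1) by omega,
    norm_sub_rev]

lemma sum_reverse (f : ℕ → ℝ) (T k : ℕ) (hk : k ≤ T) :
    ∑ t ∈ Finset.range (T + 1), f t = ∑ t ∈ Finset.range k, f t + f k +
      ∑ t ∈ Finset.range (T - k), f (T - t) := by
  have h := Finset.sum_range_add_sum_Ico f (show k + 1 ≤ T + 1 by omega)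
  rw [← h, Finset.sum_range_succ]
  congr 1
  rw [Finset.sum_Ico_eq_sum_range, ← Finset.sum_range_reflect]
  refine Finset.sum_congr (by congr 1; omega) fun t ht => ?_
  rw [Finset.mem_range] at ht
  congr 1; omega

variable {T : ℕ}

lemma wave_pos (hT : 0 < T) {t : ℕ} (ht : t < T) : 0 < wave (Real.pi / (2 * T)) t := by
  have hT' : (0 : ℝ) < T := by exact_mod_cast hT
  have h1 : ((t : ℝ) + 1) ≤ T := by exact_mod_cast ht
  unfold wave
  have hθ : 0 < Real.pi / (2 * T) := by have := Real.pi_pos; positivity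
  refine Real.cos_pos_of_mem_Ioo ⟨?_, ?_⟩
  · have : 0 < ((t : ℝ) + 1 / 2) * (Real.pi / (2 * T)) := by positivity
    linarith [Real.pi_pos]
  · calc ((t : ℝ) + 1 / 2) * (Real.pi / (2 * T)) < T * (Real.pi / (2 * T)) :=
          mul_lt_mul_of_pos_right (by linarith) hθ
      _ = Real.pi / 2 := by field_simp

/-- Beyond the last site, the zero-slope solution is antisymmetric. -/
lemma wave_last (hT : 0 < T) : wave (Real.pi / (2 * T)) T = -wave (Real.pi / (2 * T)) (T - 1) := by
  have hT' : (T : ℝ) ≠ 0 := by exact_mod_cast hT.ne'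
  unfold wave
  rw [show ((T : ℝ) + 1 / 2) * (Real.pi / (2 * T)) =
      Real.pi - ((T : ℝ) - 1 + 1 / 2) * (Real.pi / (2 * T)) by field_simp; ring, Real.cos_pi_sub]

/-- A chain of `T` sites with a unit penalty at an end has ground state energy
`1 - cos (π / (2T))`. -/
lemma energy_ge_of_penalty_last (hT : 0 < T) (u : ℕ → ℂ) :
    (1 - Real.cos (Real.pi / (2 * T))) * ∑ t ∈ Finset.range T, ‖u t‖ ^ 2 ≤
      hop u (T - 1) + ‖u (T - 1)‖ ^ 2 := by
  obtain ⟨k, rfl⟩ : ∃ k, T = k + 1 := ⟨T - 1, by omega⟩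
  set θ := Real.pi / (2 * ((k + 1 : ℕ) : ℝ)) with hθ
  have hk : 0 < wave θ k := wave_pos hT (Nat.lt_succ_self k)
  have h1 := hop_sub_ge u θ k fun t ht => wave_pos hT (Nat.lt_succ_of_le ht)
  have h2 := wave_last hT
  rw [← hθ] at h2
  have h3 := wave_add_wave θ k
  have h4 : ((k + 1 : ℕ) : ℝ) - 1 = k := by push_cast; ring
  rw [h4, Nat.cast_succ] at h2
  have h5 : wave θ (k - 1) / wave θ k = 2 * Real.cos θ + 1 := by
    rw [div_eq_iff hk.ne']; linarith
  rw [h5] at h1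
  rw [Nat.add_sub_cancel, Finset.sum_range_succ]
  nlinarith

/-- The trial amplitudes `cos ((t + 1/2) θ)` attain the ground state energy. -/
lemma energy_wave (hT : 0 < T) :
    hop (fun t => (wave (Real.pi / (2 * T)) t : ℂ)) (T - 1) + wave (Real.pi / (2 * T)) (T - 1) ^ 2 =
      (1 - Real.cos (Real.pi / (2 * T))) *
        ∑ t ∈ Finset.range T, wave (Real.pi / (2 * T)) t ^ 2 := by
  obtain ⟨k, rfl⟩ : ∃ k, T = k + 1 := ⟨T - 1, by omega⟩
  set θ := Real.pi / (2 * ((k + 1 : ℕ) : ℝ)) with hθ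
  have hA : ∀ k : ℕ, hop (fun t => (wave θ t : ℂ)) k -
      (1 - Real.cos θ) * ∑ t ∈ Finset.range k, wave θ t ^ 2 =
        1 / 2 * wave θ k * (wave θ k - wave θ (k - 1)) := by
    intro k
    induction k with
    | zero =>
      have := wave_neg_one θ
      simp only [Nat.cast_zero, this]
      simp [hop]
    | succ k ih =>
      have h3 := wave_add_wave θ k
      have h4 : ((k + 1 : ℕ) : ℝ) - 1 = k := by push_cast; ring
      rw [h4]
      simp only [hop, Finset.sum_range_succ] at ih ⊢
      rw [← Complex.ofReal_sub, Complex.norm_real, Real.norm_eq_abs, sq_abs]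
      rw [Nat.cast_succ]
      have h5 : wave θ (k - 1) = 2 * Real.cos θ * wave θ k - wave θ (k + 1) := by linarith
      rw [h5] at ih
      linear_combination ih
  have h1 := hA k
  have h2 := wave_last hT
  rw [← hθ] at h2
  have h3 := wave_add_wave θ k
  have h4 : ((k + 1 : ℕ) : ℝ) - 1 = k := by push_cast; ring
  rw [h4, Nat.cast_succ] at h2
  rw [h4, Nat.add_sub_cancel, Finset.sum_range_succ]
  have h5 : wave θ (k - 1) = (2 * Real.cos θ + 1) * wave θ k := by linarith
  rw [h5] at h1
  linear_combination h1

/-- A unit penalty at a site in the first two thirds of the chain costs at least as much as one at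
an end. -/
lemma energy_ge_of_penalty_at (hT : 0 < T) (u : ℕ → ℂ) {k : ℕ} (hk : k < T)
    (hcos : 1 / 2 ≤ wave (Real.pi / (2 * T)) k) :
    (1 - Real.cos (Real.pi / (2 * T))) * ∑ t ∈ Finset.range T, ‖u t‖ ^ 2 ≤
      hop u (T - 1) + ‖u k‖ ^ 2 := by
  obtain ⟨m, rfl⟩ : ∃ m, T = m + 1 := ⟨T - 1, by omega⟩
  have hkm : k ≤ m := by omega
  set θ := Real.pi / (2 * ((m + 1 : ℕ) : ℝ)) with hθ
  have hθ0 : 0 < θ := by have := Real.pi_pos; positivity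
  have hm0 : ((m + 1 : ℕ) : ℝ) ≠ 0 := by positivity
  have hmθ : ((m : ℝ) + 1) * θ = Real.pi / 2 := by
    rw [hθ]; push_cast; push_cast at hm0; field_simp
  have h1 := hop_sub_ge u θ k fun t ht => wave_pos hT (by omega)
  have h2 := hop_sub_ge (fun t => u (m - t)) θ (m - k) fun t ht => wave_pos hT (by omega)
  have hs1 := hop_reverse u m k hkm
  have hs2 := sum_reverse (fun t => ‖u t‖ ^ 2) m k hkm
  have hcast : ((m - k : ℕ) : ℝ) = m - k := Nat.cast_sub hkm
  rw [hcast, show m - (m - k) = k by omega] at h2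
  have hpos2 : 0 < wave θ ((m : ℝ) - k) := by
    rw [← hcast]; exact wave_pos hT (by omega)
  -- on the reversed part the zero-slope solution is a sine
  have hw1 : wave θ ((m : ℝ) - k) = Real.sin (((k : ℝ) + 1 / 2) * θ) := by
    unfold wave
    rw [← Real.cos_pi_div_two_sub, ← hmθ]; congr 1; ring
  have hw2 := wave_add_wave θ ((m : ℝ) - k)
  have hw3 : wave θ ((m : ℝ) - k + 1) = Real.sin (((k : ℝ) - 1 / 2) * θ) := by
    unfold wave
    rw [← Real.cos_pi_div_two_sub, ← hmθ]; congr 1; ring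
  have hkpos : 0 < wave θ k := by linarith
  -- for `k = 0` this is an equality, otherwise the left ratio is at most `2`
  have key : wave θ (k - 1) / wave θ k + wave θ ((m : ℝ) - k - 1) / wave θ ((m : ℝ) - k) ≤
      2 + 2 * Real.cos θ := by
    have e : wave θ ((m : ℝ) - k - 1) / wave θ ((m : ℝ) - k) =
        2 * Real.cos θ - wave θ ((m : ℝ) - k + 1) / wave θ ((m : ℝ) - k) := by
      rw [eq_sub_iff_add_eq, ← add_div, hw2, mul_div_assoc, div_self hpos2.ne', mul_one]
    rw [e]
    rcases Nat.eq_zero_or_pos k with h0 | h0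
    · have e1 : wave θ ((k : ℝ) - 1) / wave θ k = 1 := by
        rw [h0] at hkpos ⊢
        rw [Nat.cast_zero] at hkpos ⊢
        rw [wave_neg_one, div_self hkpos.ne']
      have e2 : wave θ ((m : ℝ) - k + 1) / wave θ ((m : ℝ) - k) = -1 := by
        rw [div_eq_iff hpos2.ne', hw1, hw3, h0, Nat.cast_zero, neg_one_mul, ← Real.sin_neg]
        congr 1; ring
      rw [e1, e2]; linarith
    · have e1 : wave θ ((k : ℝ) - 1) / wave θ k ≤ 2 := by
        rw [div_le_iff₀ hkpos]
        have := Real.cos_le_one (((k : ℝ) - 1 + 1 / 2) * θ)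
        unfold wave at hcos ⊢
        linarith
      have e2 : 0 ≤ wave θ ((m : ℝ) - k + 1) / wave θ ((m : ℝ) - k) := by
        refine div_nonneg ?_ hpos2.le
        rw [hw3]
        have hk1 : (1 : ℝ) ≤ k := by exact_mod_cast h0
        have hk2 : (k : ℝ) ≤ m := by exact_mod_cast hkm
        refine Real.sin_nonneg_of_nonneg_of_le_pi (by nlinarith) ?_
        have : ((k : ℝ) - 1 / 2) * θ ≤ ((m : ℝ) + 1) * θ :=
          mul_le_mul_of_nonneg_right (by linarith) hθ0.le
        linarith [Real.pi_pos]
      linarith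
  rw [Nat.add_sub_cancel, hs1, hs2]
  have h6 : 0 ≤ (2 + 2 * Real.cos θ - (wave θ (k - 1) / wave θ k +
      wave θ ((m : ℝ) - k - 1) / wave θ ((m : ℝ) - k))) * ‖u k‖ ^ 2 :=
    mul_nonneg (by linarith) (sq_nonneg _)
  linarith

end PathChain

/-! ### Tensor powers and the majority vote -/

section TensorPow

variable {ρ ω : Type*}

/-- The `k`-th tensor power of a matrix. -/
def tensorPow (A : Matrix ρ ω ℂ) (k : ℕ) : Matrix (Fin k → ρ) (Fin k → ω) ℂ :=
  Matrix.of fun z w => ∏ j, A (z j) (w j)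

lemma sqNorm_cons [Fintype ρ] {k : ℕ} (Ψ : (Fin (k + 1) → ρ) → ℂ) :
    sqNorm Ψ = ∑ z₀, sqNorm fun z : Fin k → ρ => Ψ (Fin.cons z₀ z) := by
  unfold sqNorm
  rw [← Fintype.sum_prod_type' (f := fun (z₀ : ρ) (z : Fin k → ρ) =>
    ‖Ψ (Fin.cons z₀ z : Fin (k + 1) → ρ)‖ ^ 2)]
  exact (Fintype.sum_equiv (Fin.consEquiv fun _ : Fin (k + 1) => ρ) _ _ fun x => rfl).symm

lemma tensorPow_mulVec_cons [Fintype ω] (A : Matrix ρ ω ℂ) {k : ℕ}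
    (Ψ : (Fin (k + 1) → ω) → ℂ) (z₀ : ρ) (z : Fin k → ρ) :
    (tensorPow A (k + 1) *ᵥ Ψ) (Fin.cons z₀ z) =
      (A *ᵥ fun w₀ => (tensorPow A k *ᵥ fun w => Ψ (Fin.cons w₀ w)) z) z₀ := by
  simp only [Matrix.mulVec, dotProduct, tensorPow, Matrix.of_apply, Fin.prod_univ_succ,
    Fin.cons_zero, Fin.cons_succ, Finset.mul_sum]
  rw [← Fintype.sum_prod_type' (f := fun (w₀ : ω) (w : Fin k → ω) =>
    A z₀ w₀ * ((∏ j, A (z j) (w j)) * Ψ (Fin.cons w₀ w : Fin (k + 1) → ω)))]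
  refine (Fintype.sum_equiv (Fin.consEquiv fun _ : Fin (k + 1) => ω) _ _ fun x => ?_).symm
  simp [Fin.consEquiv, mul_assoc]

/-- A bound on the squared operator norm is multiplicative under tensor powers, which covers
entangled vectors. -/
lemma sqNorm_tensorPow_mulVec_le [Fintype ρ] [Fintype ω] {A : Matrix ρ ω ℂ} {μ : ℝ} (hμ : 0 ≤ μ)
    (hA : ∀ ψ, sqNorm (A *ᵥ ψ) ≤ μ * sqNorm ψ) (k : ℕ) (Ψ : (Fin k → ω) → ℂ) :
    sqNorm (tensorPow A k *ᵥ Ψ) ≤ μ ^ k * sqNorm Ψ := by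
  induction k with
  | zero => simp [sqNorm, tensorPow, Matrix.mulVec, dotProduct]
  | succ k ih =>
    calc sqNorm (tensorPow A (k + 1) *ᵥ Ψ)
        = ∑ z : Fin k → ρ,
            sqNorm (A *ᵥ fun w₀ => (tensorPow A k *ᵥ fun w => Ψ (Fin.cons w₀ w)) z) := by
          rw [sqNorm_cons]
          simp only [sqNorm, tensorPow_mulVec_cons]
          exact Finset.sum_comm
      _ ≤ ∑ z : Fin k → ρ,
            μ * sqNorm fun w₀ => (tensorPow A k *ᵥ fun w => Ψ (Fin.cons w₀ w)) z :=
          Finset.sum_le_sum fun z _ => hA _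
      _ = μ * ∑ w₀, sqNorm (tensorPow A k *ᵥ fun w => Ψ (Fin.cons w₀ w)) := by
          rw [← Finset.mul_sum]
          simp only [sqNorm]
          rw [Finset.sum_comm]
      _ ≤ μ * ∑ w₀, μ ^ k * sqNorm fun w : Fin k → ω => Ψ (Fin.cons w₀ w) :=
          mul_le_mul_of_nonneg_left (Finset.sum_le_sum fun w₀ _ => ih _) hμ
      _ = μ ^ (k + 1) * sqNorm Ψ := by
          rw [← Finset.mul_sum, sqNorm_cons Ψ]
          ring

lemma tensorPow_isometry [Fintype ρ] [DecidableEq ω] {A : Matrix ρ ω ℂ} (hA : Aᴴ * A = 1) (k : ℕ) :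
    (tensorPow A k)ᴴ * tensorPow A k = 1 := by
  ext w w'
  have h : ∀ j, ∑ z, star (A z (w j)) * A z (w' j) = (1 : Matrix ω ω ℂ) (w j) (w' j) := by
    intro j
    rw [← hA]
    rfl
  simp only [Matrix.mul_apply, Matrix.conjTranspose_apply, tensorPow, Matrix.of_apply, star_prod,
    ← Finset.prod_mul_distrib]
  have h2 := Finset.prod_univ_sum (fun _ : Fin k => (Finset.univ : Finset ρ))
    (fun j z => star (A z (w j)) * A z (w' j))
  rw [Fintype.piFinset_univ] at h2
  rw [← h2, Finset.prod_congr rfl fun j _ => h j]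
  by_cases hw : w = w'
  · subst hw; simp
  · rw [Matrix.one_apply_ne hw]
    obtain ⟨j, hj⟩ := Function.ne_iff.mp hw
    exact Finset.prod_eq_zero (Finset.mem_univ j) (Matrix.one_apply_ne hj)

lemma tensorPow_mulVec_prod [Fintype ω] (A : Matrix ρ ω ℂ) (k : ℕ) (ψ : ω → ℂ) :
    (tensorPow A k *ᵥ fun w => ∏ j, ψ (w j)) = fun z => ∏ j, (A *ᵥ ψ) (z j) := by
  funext z
  simp only [Matrix.mulVec, dotProduct, tensorPow, Matrix.of_apply, ← Finset.prod_mul_distrib]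
  have h2 := Finset.prod_univ_sum (fun _ : Fin k => (Finset.univ : Finset ω))
    (fun j w => A (z j) w * ψ w)
  rw [Fintype.piFinset_univ] at h2
  exact h2.symm

lemma sqNorm_prod [Fintype ρ] (k : ℕ) (φ : ρ → ℂ) :
    sqNorm (fun z : Fin k → ρ => ∏ j, φ (z j)) = sqNorm φ ^ k := by
  have h2 := Finset.prod_univ_sum (fun _ : Fin k => (Finset.univ : Finset ρ))
    (fun _ z => ‖φ z‖ ^ 2)
  rw [Fintype.piFinset_univ, Finset.prod_const, Finset.card_univ, Fintype.card_fin] at h2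
  simp only [sqNorm, h2, norm_prod, Finset.prod_pow]

/-- The rows of `A` in `P` weighted by `√2`: the squared norm then counts outcomes in `P` twice. -/
noncomputable def weighted (P : ρ → Prop) [DecidablePred P] (A : Matrix ρ ω ℂ) : Matrix ρ ω ℂ :=
  Matrix.of fun z w => (if P z then (Real.sqrt 2 : ℂ) else 1) * A z w

lemma norm_weight_sq (P : Prop) [Decidable P] :
    ‖(if P then (Real.sqrt 2 : ℂ) else 1)‖ ^ 2 = if P then 2 else 1 := by
  split_ifs
  · rw [Complex.norm_real, Real.norm_eq_abs, sq_abs, Real.sq_sqrt (by norm_num)]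
  · simp

lemma sqNorm_weighted_mulVec [Fintype ρ] [Fintype ω] (P : ρ → Prop) [DecidablePred P]
    (A : Matrix ρ ω ℂ) (ψ : ω → ℂ) :
    sqNorm (weighted P A *ᵥ ψ) =
      sqNorm (A *ᵥ ψ) + ∑ z, if P z then ‖(A *ᵥ ψ) z‖ ^ 2 else 0 := by
  simp only [sqNorm]
  rw [← Finset.sum_add_distrib]
  refine Finset.sum_congr rfl fun z _ => ?_
  have : (weighted P A *ᵥ ψ) z = (if P z then (Real.sqrt 2 : ℂ) else 1) * (A *ᵥ ψ) z := by
    simp only [Matrix.mulVec, dotProduct, weighted, Matrix.of_apply, Finset.mul_sum, mul_assoc]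
  rw [this, norm_mul, mul_pow, norm_weight_sq]
  split_ifs <;> ring

/-- The exponential moment bound for the event that at least half of `k` outcomes lie in `P`:
weighting every such outcome with `2` gives these events weight at least `√2 ^ k`. -/
lemma sqrt_two_pow_mul_le [Fintype ρ] [Fintype ω] (P : ρ → Prop) [DecidablePred P]
    (A : Matrix ρ ω ℂ) (k : ℕ)
    (Ψ : (Fin k → ω) → ℂ) :
    Real.sqrt 2 ^ k * (∑ z : Fin k → ρ,
      if k ≤ 2 * (Finset.univ.filter fun j => P (z j)).card then
        ‖(tensorPow A k *ᵥ Ψ) z‖ ^ 2 else 0) ≤ sqNorm (tensorPow (weighted P A) k *ᵥ Ψ) := by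
  rw [Finset.mul_sum]
  refine Finset.sum_le_sum fun z _ => ?_
  have h1 : (tensorPow (weighted P A) k *ᵥ Ψ) z =
      (∏ j, if P (z j) then (Real.sqrt 2 : ℂ) else 1) * (tensorPow A k *ᵥ Ψ) z := by
    simp only [Matrix.mulVec, dotProduct, tensorPow, weighted, Matrix.of_apply, Finset.mul_sum,
      Finset.prod_mul_distrib, mul_assoc]
  have h2 : ‖∏ j, if P (z j) then (Real.sqrt 2 : ℂ) else 1‖ ^ 2 =
      2 ^ (Finset.univ.filter fun j => P (z j)).card := by
    rw [norm_prod, ← Finset.prod_pow]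
    simp only [norm_weight_sq]
    rw [Finset.prod_ite]
    simp
  rw [h1, norm_mul, mul_pow, h2]
  split_ifs with h
  · refine mul_le_mul_of_nonneg_right ?_ (sq_nonneg _)
    calc Real.sqrt 2 ^ k ≤ Real.sqrt 2 ^ (2 * (Finset.univ.filter fun j => P (z j)).card) :=
          pow_le_pow_right₀ (by rw [Real.one_le_sqrt]; norm_num) h
      _ = 2 ^ (Finset.univ.filter fun j => P (z j)).card := by
          rw [pow_mul, Real.sq_sqrt (by norm_num)]
  · rw [mul_zero]; positivity

end TensorPow

/-- `k ≥ 4 q / log (9/8)` repetitions push the exponential moment bound below `e^{-2q}`. -/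
lemma le_exp_of_sqrt_two_pow_mul_le {k : ℕ} {q a : ℝ}
    (hk : 4 / Real.log (9 / 8) * q ≤ k) (h : Real.sqrt 2 ^ k * a ≤ (4 / 3) ^ k) :
    a ≤ Real.exp (-(2 * q)) := by
  have hlog : 0 < Real.log (9 / 8) := Real.log_pos (by norm_num)
  have hs : 0 < Real.sqrt 2 ^ k := by positivity
  have h1 : a ≤ (4 / 3) ^ k / Real.sqrt 2 ^ k := by
    rw [le_div_iff₀ hs]; linarith
  refine h1.trans ?_
  rw [← div_pow]
  have hr : (4 / 3 : ℝ) / Real.sqrt 2 = Real.exp (-(Real.log (9 / 8) / 2)) := by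
    have hp : (0 : ℝ) < 4 / 3 / Real.sqrt 2 := by positivity
    rw [← Real.exp_log hp]
    congr 1
    have : 2 * Real.log (4 / 3 / Real.sqrt 2) = -Real.log (9 / 8) := by
      rw [← Real.log_inv, ← Nat.cast_ofNat, ← Real.log_pow, div_pow, Real.sq_sqrt (by norm_num)]
      norm_num
    linarith
  rw [hr, ← Real.exp_nat_mul]
  refine Real.exp_le_exp.mpr ?_
  have : 4 * q ≤ k * Real.log (9 / 8) := by
    rw [div_mul_eq_mul_div, div_le_iff₀ hlog] at hk
    exact hk
  nlinarith

/-! ### Verification circuits and their repetitions -/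

namespace Verifier

lemma circuit_isometry (V : Verifier) : V.circuitᴴ * V.circuit = 1 := by
  have key : ∀ (l : List (Gate (Fin V.wit ⊕ Fin V.anc))) (M : Matrix V.Reg V.Reg ℂ), Mᴴ * M = 1 →
      (l.foldl (fun M g => onPair g.fst g.snd (g.unitary : Matrix _ _ ℂ) * M) M)ᴴ *
        l.foldl (fun M g => onPair g.fst g.snd (g.unitary : Matrix _ _ ℂ) * M) M = 1 := by
    intro l
    induction l with
    | nil => intro M hM; exact hM
    | cons g l ih =>
      intro M hM
      refine ih _ ?_
      rw [Matrix.conjTranspose_mul, Matrix.mul_assoc, ← Matrix.mul_assoc _ _ M,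
        onPair_unitary g.ne, Matrix.one_mul, hM]
  exact key _ _ (by simp)

lemma run_isometry (V : Verifier) : V.runᴴ * V.run = 1 := by
  have h : V.run = V.circuit.submatrix id fun w : V.Wit => Sum.elim w fun _ => 0 := rfl
  rw [h, Matrix.conjTranspose_submatrix, ← Matrix.submatrix_mul _ _ _ id _ Function.bijective_id,
    circuit_isometry]
  refine Matrix.submatrix_one _ fun w w' hw => ?_
  funext i
  exact congrFun hw (Sum.inl i)

lemma acceptProb_add_rejectProb (V : Verifier) (ψ : V.Wit → ℂ) :
    V.acceptProb ψ + V.rejectProb ψ = sqNorm ψ := by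
  rw [← sqNorm_mulVec_of_isometry V.run_isometry ψ, acceptProb, rejectProb, sqNorm,
    ← Finset.sum_add_distrib]
  refine Finset.sum_congr rfl fun z _ => ?_
  split_ifs <;> simp

lemma acceptProb_nonneg (V : Verifier) (ψ : V.Wit → ℂ) : 0 ≤ V.acceptProb ψ :=
  Finset.sum_nonneg fun z _ => by split_ifs <;> positivity

lemma acceptProb_smul (V : Verifier) (c : ℂ) (ψ : V.Wit → ℂ) :
    V.acceptProb (c • ψ) = ‖c‖ ^ 2 * V.acceptProb ψ := by
  rw [acceptProb, acceptProb, Finset.mul_sum]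
  refine Finset.sum_congr rfl fun z _ => ?_
  rw [Matrix.mulVec_smul, Pi.smul_apply, smul_eq_mul, norm_mul, mul_pow]
  split_ifs <;> simp

/-- Soundness extends from unit vectors to all vectors by homogeneity. -/
lemma acceptProb_le_mul_sqNorm (V : Verifier) {δ : ℝ}
    (h : ∀ ψ : V.Wit → ℂ, sqNorm ψ = 1 → V.acceptProb ψ ≤ δ) (ψ : V.Wit → ℂ) :
    V.acceptProb ψ ≤ δ * sqNorm ψ := by
  by_cases hψ : ψ = 0
  · subst hψ
    simp [acceptProb]
  · have hp := sqNorm_pos hψ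
    have hn : ‖((Real.sqrt (sqNorm ψ))⁻¹ : ℂ)‖ ^ 2 = (sqNorm ψ)⁻¹ := by
      rw [norm_inv, Complex.norm_real, Real.norm_eq_abs, inv_pow, sq_abs, Real.sq_sqrt hp.le]
    have h1 := h (((Real.sqrt (sqNorm ψ))⁻¹ : ℂ) • ψ)
      (by rw [sqNorm_smul, hn, inv_mul_cancel₀ hp.ne'])
    rw [acceptProb_smul, hn, inv_mul_le_iff₀ hp] at h1
    linarith

lemma runPow_eq (V : Verifier) (k : ℕ) : V.runPow k = tensorPow V.run k := rfl

lemma sqNorm_runPow (V : Verifier) (k : ℕ) (Ψ : (Fin k → V.Wit) → ℂ) :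
    sqNorm (tensorPow V.run k *ᵥ Ψ) = sqNorm Ψ :=
  sqNorm_mulVec_of_isometry (tensorPow_isometry V.run_isometry k) Ψ

lemma rejectProbPow_le (V : Verifier) (k : ℕ) (Ψ : (Fin k → V.Wit) → ℂ) :
    V.rejectProbPow k Ψ ≤ sqNorm Ψ := by
  rw [← V.sqNorm_runPow, rejectProbPow, runPow_eq]
  refine Finset.sum_le_sum fun z _ => ?_
  split_ifs
  · positivity
  · exact le_rfl

/-- Completeness of the repetition: independent copies of a witness are rejected with exponentially
small probability. -/
lemma rejectProbPow_prod_le (V : Verifier) {k : ℕ} {q : ℝ}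
    (hk : 4 / Real.log (9 / 8) * q ≤ k) {ψ : V.Wit → ℂ} (hψ : sqNorm ψ = 1)
    (hacc : 1 - 1 / 3 ≤ V.acceptProb ψ) :
    V.rejectProbPow k (fun w => ∏ j, ψ (w j)) ≤ Real.exp (-(2 * q)) := by
  refine le_exp_of_sqrt_two_pow_mul_le hk ?_
  have h1 := sqrt_two_pow_mul_le (fun z : V.Reg => ¬ z V.out = 1) V.run k fun w => ∏ j, ψ (w j)
  have h2 : sqNorm (weighted (fun z : V.Reg => ¬ z V.out = 1) V.run *ᵥ ψ) ≤ 4 / 3 := by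
    have h3 := V.acceptProb_add_rejectProb ψ
    have h4 : (∑ z : V.Reg, if ¬ z V.out = 1 then ‖(V.run *ᵥ ψ) z‖ ^ 2 else 0) =
        V.rejectProb ψ := by
      simp only [ite_not]; rfl
    rw [sqNorm_weighted_mulVec, sqNorm_mulVec_of_isometry V.run_isometry, h4]
    linarith
  rw [tensorPow_mulVec_prod (weighted _ V.run), sqNorm_prod] at h1
  refine le_trans ?_ (h1.trans (pow_le_pow_left₀ (sqNorm_nonneg _) h2 k))
  refine mul_le_mul_of_nonneg_left (Finset.sum_le_sum fun z _ => ?_) (by positivity)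
  rw [runPow_eq]
  have hc := Finset.card_filter_add_card_filter_not (s := (Finset.univ : Finset (Fin k)))
    (fun j => z j V.out = 1)
  rw [Finset.card_univ, Fintype.card_fin] at hc
  by_cases h : k < 2 * (Finset.univ.filter fun j => z j V.out = 1).card
  · rw [if_pos h]; split_ifs <;> positivity
  · rw [if_neg h, if_pos (by omega)]

/-- Soundness of the repetition, also against entangled witnesses. -/
lemma sub_exp_mul_le_rejectProbPow (V : Verifier) {k : ℕ} {q : ℝ}
    (hk : 4 / Real.log (9 / 8) * q ≤ k)
    (hsound : ∀ ψ : V.Wit → ℂ, sqNorm ψ = 1 → V.acceptProb ψ ≤ 1 / 3)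
    (Ψ : (Fin k → V.Wit) → ℂ) :
    (1 - Real.exp (-(2 * q))) * sqNorm Ψ ≤ V.rejectProbPow k Ψ := by
  set A : ℝ := ∑ z : Fin k → V.Reg,
    if k ≤ 2 * (Finset.univ.filter fun j => z j V.out = 1).card then
      ‖(tensorPow V.run k *ᵥ Ψ) z‖ ^ 2 else 0 with hA
  have hsum : sqNorm Ψ ≤ V.rejectProbPow k Ψ + A := by
    rw [← V.sqNorm_runPow, rejectProbPow, runPow_eq, hA, ← Finset.sum_add_distrib]
    refine Finset.sum_le_sum fun z _ => ?_
    by_cases h : k < 2 * (Finset.univ.filter fun j => z j V.out = 1).card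
    · rw [if_pos h, if_pos h.le, zero_add]
    · rw [if_neg h]
      have : (0 : ℝ) ≤ if k ≤ 2 * (Finset.univ.filter fun j => z j V.out = 1).card then
        ‖(tensorPow V.run k *ᵥ Ψ) z‖ ^ 2 else 0 := by split_ifs <;> positivity
      linarith
  have h2 : ∀ ψ, sqNorm (weighted (fun z : V.Reg => z V.out = 1) V.run *ᵥ ψ) ≤
      4 / 3 * sqNorm ψ := by
    intro ψ
    have h4 : (∑ z : V.Reg, if z V.out = 1 then ‖(V.run *ᵥ ψ) z‖ ^ 2 else 0) = V.acceptProb ψ := rfl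
    rw [sqNorm_weighted_mulVec, sqNorm_mulVec_of_isometry V.run_isometry, h4]
    linarith [V.acceptProb_le_mul_sqNorm hsound ψ]
  have h1 := (sqrt_two_pow_mul_le (fun z : V.Reg => z V.out = 1) V.run k Ψ).trans
    (sqNorm_tensorPow_mulVec_le (by norm_num) h2 k Ψ)
  rw [← hA] at h1
  have h3 : A ≤ Real.exp (-(2 * q)) * sqNorm Ψ := by
    rcases (sqNorm_nonneg Ψ).eq_or_lt with h0 | h0
    · rw [← h0, mul_zero] at h1 ⊢
      exact nonpos_of_mul_nonpos_right h1 (by positivity)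
    · rw [← div_le_iff₀ h0]
      refine le_exp_of_sqrt_two_pow_mul_le hk ?_
      rw [← mul_div_assoc, div_le_iff₀ h0]
      exact h1
  linarith

end Verifier

/-! ### Legal evolutions -/

namespace StandardForm

variable {n C Q : ℕ} {H : StandardForm n C Q}

/-- `W` contains the legal clock states, is closed under the transition rules, and at most one rule
applies in each direction to each of its members. -/
structure IsDeterministicOn (H : StandardForm n C Q) (W : Set (Clock n C)) : Prop where
  mem_of_legal : ∀ s, H.Legal s → s ∈ W
  closed : ∀ s s', H.Step s s' → (s ∈ W ↔ s' ∈ W)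
  forward : ∀ s ∈ W, ∀ i cd j cd', (H.rule i (pairAt s i) cd).isSome →
      (H.rule j (pairAt s j) cd').isSome → i = j ∧ cd = cd'
  backward : ∀ s ∈ W, ∀ i ab j ab', (H.rule i ab (pairAt s i)).isSome →
      (H.rule j ab' (pairAt s j)).isSome → i = j ∧ ab = ab'

lemma IsStandardClock.exists_isDeterministicOn {a b c : ℝ} {T Tinit : ℕ}
    (h : H.IsStandardClock a b c T Tinit) : ∃ W, H.IsDeterministicOn W := by
  obtain ⟨W, h1, h2, h3, h4⟩ := h.single
  exact ⟨W, h1, h2, h3, h4⟩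

lemma step_updBond {b : Bond n} {s : Clock n C} {cd : Fin C × Fin C}
    (h : (H.rule b (pairAt s b) cd).isSome) : H.Step s (updBond b s cd) :=
  ⟨b, by rwa [pairAt_updBond], updBond_agree b s cd⟩

lemma transEnergy_eq_zero (v : (Fin n → Fin C × Fin Q) → ℂ) {s : Clock n C}
    (h : ∀ s', H.Step s s' → block v s' = 0) (hs : block v s = 0) : H.transEnergy v s = 0 := by
  refine Finset.sum_eq_zero fun b _ => Finset.sum_eq_zero fun cd _ => ?_
  cases hr : H.rule b (pairAt s b) cd with
  | none => rfl
  | some U =>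
    simp only
    rw [h _ (step_updBond (by rw [hr]; rfl)), hs, Matrix.mulVec_zero, sub_zero, sqNorm_zero,
      mul_zero]

lemma transEnergy_eq_zero_of_no_step (v : (Fin n → Fin C × Fin Q) → ℂ) {s : Clock n C}
    (h : ∀ s', ¬ H.Step s s') : H.transEnergy v s = 0 := by
  refine Finset.sum_eq_zero fun b _ => Finset.sum_eq_zero fun cd _ => ?_
  cases hr : H.rule b (pairAt s b) cd with
  | none => rfl
  | some U => exact absurd (step_updBond (by rw [hr]; rfl)) (h (updBond b s cd))

namespace IsDeterministicOn

variable {W : Set (Clock n C)}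

lemma step_right_unique (hD : H.IsDeterministicOn W) {s s' s'' : Clock n C} (hs : s ∈ W)
    (h' : H.Step s s') (h'' : H.Step s s'') : s' = s'' := by
  obtain ⟨b, h1, h2⟩ := h'
  obtain ⟨b', h3, h4⟩ := h''
  obtain ⟨rfl, hcd⟩ := hD.forward s hs _ _ _ _ h1 h3
  rw [← updBond_pairAt h2, ← updBond_pairAt h4, hcd]

lemma step_left_unique (hD : H.IsDeterministicOn W) {s s' s'' : Clock n C} (hs : s ∈ W)
    (h' : H.Step s' s) (h'' : H.Step s'' s) : s' = s'' := by
  obtain ⟨b, h1, h2⟩ := h'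
  obtain ⟨b', h3, h4⟩ := h''
  obtain ⟨rfl, hab⟩ := hD.backward s hs _ _ _ _ h1 h3
  rw [← updBond_pairAt fun l hl hr => (h2 l hl hr).symm,
    ← updBond_pairAt fun l hl hr => (h4 l hl hr).symm, hab]

/-- On a deterministic clock state exactly one rule contributes to `stepOp` and to the transition
energy. -/
lemma exists_rule (hD : H.IsDeterministicOn W) {s s' : Clock n C} (hs : s ∈ W)
    (h : H.Step s s') : ∃ (b : Bond n) (U : Matrix.unitaryGroup (Fin Q × Fin Q) ℂ),
      H.stepOp s s' = onPair b.left b.right (U : Matrix _ _ ℂ) ∧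
      ∀ v, H.transEnergy v s = 1 / 2 * sqNorm (block v s' - H.stepOp s s' *ᵥ block v s) := by
  classical
  obtain ⟨b, h1, h2⟩ := h
  obtain ⟨U, hU⟩ := Option.isSome_iff_exists.mp h1
  have hop : H.stepOp s s' = onPair b.left b.right (U : Matrix _ _ ℂ) := by
    rw [stepOp, Finset.sum_eq_single b]
    · rw [if_pos h2, hU]
    · intro b' _ hb'
      cases hr : H.rule b' (pairAt s b') (pairAt s' b') with
      | none => simp
      | some U' => exact absurd (hD.forward s hs _ _ _ _ (by rw [hr]; rfl) h1).1 hb'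
    · simp
  refine ⟨b, U, hop, fun v => ?_⟩
  rw [hop, transEnergy, Finset.sum_eq_single b, Finset.sum_eq_single (pairAt s' b)]
  · rw [hU, updBond_pairAt h2]
  · intro cd _ hcd
    cases hr : H.rule b (pairAt s b) cd with
    | none => rfl
    | some U' => exact absurd (hD.forward s hs _ _ _ _ (by rw [hr]; rfl) h1).2 hcd
  · simp
  · intro b' _ hb'
    refine Finset.sum_eq_zero fun cd _ => ?_
    cases hr : H.rule b' (pairAt s b') cd with
    | none => rfl
    | some U' => exact absurd (hD.forward s hs _ _ _ _ (by rw [hr]; rfl) h1).1 hb'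
  · simp

lemma transEnergy_eq (hD : H.IsDeterministicOn W) {s s' : Clock n C} (hs : s ∈ W)
    (h : H.Step s s') (v : (Fin n → Fin C × Fin Q) → ℂ) :
    H.transEnergy v s = 1 / 2 * sqNorm (block v s' - H.stepOp s s' *ᵥ block v s) := by
  obtain ⟨_, _, _, h2⟩ := hD.exists_rule hs h
  exact h2 v

lemma stepOp_isometry (hD : H.IsDeterministicOn W) {s s' : Clock n C} (hs : s ∈ W)
    (h : H.Step s s') : (H.stepOp s s')ᴴ * H.stepOp s s' = 1 := by
  obtain ⟨b, U, h1, _⟩ := hD.exists_rule hs h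
  rw [h1, onPair_unitary b.left_ne_right]

end IsDeterministicOn

namespace IsRun

variable {W : Set (Clock n C)} {T : ℕ} {γ γ' : ℕ → Clock n C}

lemma not_step_first (hγ : H.IsRun T γ) (s : Clock n C) : ¬ H.Step s (γ 0) := by
  rintro ⟨b, h, -⟩
  rw [hγ.first] at h
  simp at h

lemma not_step_last (hγ : H.IsRun T γ) (s : Clock n C) : ¬ H.Step (γ (T - 1)) s := by
  rintro ⟨b, h, -⟩
  rw [hγ.last] at h
  simp at h

lemma mem (hγ : H.IsRun T γ) (hD : H.IsDeterministicOn W) {t : ℕ} (ht : t < T) : γ t ∈ W :=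
  hD.mem_of_legal _ (hγ.legal t ht)

/-- Legal evolutions that meet coincide, and they meet at equal times. -/
lemma eq_of_apply_eq (hγ : H.IsRun T γ) (hγ' : H.IsRun T γ') (hD : H.IsDeterministicOn W) :
    ∀ {t t' : ℕ}, t < T → t' < T → γ t = γ' t' → t = t' ∧ γ 0 = γ' 0
  | 0, 0, _, _, h => ⟨rfl, h⟩
  | 0, t' + 1, _, ht', h => absurd (h ▸ hγ'.step t' ht') (hγ.not_step_first _)
  | t + 1, 0, ht, _, h => absurd (h ▸ hγ.step t ht) (hγ'.not_step_first _)
  | t + 1, t' + 1, ht, ht', h => by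
    have h1 : H.Step (γ' t') (γ (t + 1)) := by rw [h]; exact hγ'.step t' ht'
    have h2 := eq_of_apply_eq hγ hγ' hD (Nat.lt_of_succ_lt ht) (Nat.lt_of_succ_lt ht')
      (hD.step_left_unique (hγ.mem hD ht) (hγ.step t ht) h1)
    exact ⟨by rw [h2.1], h2.2⟩

lemma exists_of_step_left (hγ : H.IsRun T γ) (hD : H.IsDeterministicOn W) {s : Clock n C} {t : ℕ}
    (ht : t < T) (h : H.Step s (γ t)) : ∃ t' < T, γ t' = s := by
  cases t with
  | zero => exact absurd h (hγ.not_step_first s)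
  | succ t => exact ⟨t, Nat.lt_of_succ_lt ht,
      hD.step_left_unique (hγ.mem hD ht) (hγ.step t ht) h⟩

lemma exists_of_step_right (hγ : H.IsRun T γ) (hD : H.IsDeterministicOn W) {s : Clock n C}
    {t : ℕ} (ht : t < T) (h : H.Step (γ t) s) : ∃ t' < T, γ t' = s := by
  by_cases h' : t + 1 < T
  · exact ⟨t + 1, h', hD.step_right_unique (hγ.mem hD ht) (hγ.step t h') h⟩
  · obtain rfl : t = T - 1 := by omega
    exact absurd h (hγ.not_step_last s)

lemma evolve_isometry (hγ : H.IsRun T γ) (hD : H.IsDeterministicOn W) {t : ℕ} (ht : t < T) :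
    (H.evolve γ t)ᴴ * H.evolve γ t = 1 := by
  induction t with
  | zero => simp [evolve]
  | succ t ih =>
    have ht' := Nat.lt_of_succ_lt ht
    rw [evolve, Matrix.conjTranspose_mul, Matrix.mul_assoc, ← Matrix.mul_assoc _ _ (H.evolve γ t),
      hD.stepOp_isometry (hγ.mem hD ht') (hγ.step t ht), Matrix.one_mul, ih ht']

variable {a b c : ℝ} {Tinit : ℕ}

lemma evolve_init (hγ : H.IsRun T γ) (hH : H.IsStandardClock a b c T Tinit) {t : ℕ} (ht : t < T)
    (hti : t ≤ Tinit) : H.evolve γ t = 1 := by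
  induction t with
  | zero => rfl
  | succ t ih =>
    rw [evolve, hH.init_trivial γ hγ t ht hti, ih (Nat.lt_of_succ_lt ht) (Nat.le_of_succ_le hti),
      Matrix.one_mul]

lemma quadForm_inOp_evolve (hγ : H.IsRun T γ) (hH : H.IsStandardClock a b c T Tinit) {t : ℕ}
    (ht : t < T) (w : Comp n Q → ℂ) :
    quadForm (H.inOp (γ t)) (H.evolve γ t *ᵥ w) = quadForm (H.inOp (γ t)) w := by
  classical
  by_cases hti : t ≤ Tinit
  · rw [hγ.evolve_init hH ht hti, Matrix.one_mulVec]
  · have h0 : ∀ w : Comp n Q → ℂ, quadForm (H.inOp (γ t)) w = 0 := by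
      intro w
      rw [quadForm_inOp]
      refine Finset.sum_eq_zero fun i _ => Finset.sum_eq_zero fun q _ => ?_
      rw [if_neg fun h => hti (hH.in_init γ hγ t ht i ⟨_, h⟩), zero_mul]
    rw [h0, h0]

lemma quadForm_outOp_eq_zero (hγ : H.IsRun T γ) (hH : H.IsStandardClock a b c T Tinit) {t : ℕ}
    (ht : t + 1 < T) (w : Comp n Q → ℂ) : quadForm (H.outOp (γ t)) w = 0 := by
  classical
  have h := hH.final_detect γ hγ t (Nat.lt_of_succ_lt ht)
  rw [if_neg ht.ne, Set.ncard_eq_zero] at h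
  rw [quadForm_outOp]
  refine Finset.sum_eq_zero fun i _ => Finset.sum_eq_zero fun q _ => ?_
  have hi : i ∉ {i : Bond n | pairAt (γ t) i = H.outPair i} := by rw [h]; simp
  rw [if_neg fun h' => hi h'.1, zero_mul]

open Classical in
/-- At the last clock state the output penalty acts as a projector onto basis states. -/
lemma exists_quadForm_outOp (hγ : H.IsRun T γ) (hH : H.IsStandardClock a b c T Tinit) :
    ∃ S : Set (Comp n Q), ∀ w : Comp n Q → ℂ,
      quadForm (H.outOp (γ (T - 1))) w = ∑ q, if q ∈ S then ‖w q‖ ^ 2 else 0 := by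
  have hT := hγ.pos
  have h := hH.final_detect γ hγ (T - 1) (by omega)
  rw [if_pos (by omega), Set.ncard_eq_one] at h
  obtain ⟨b₀, hb₀⟩ := h
  have hmem : ∀ i, pairAt (γ (T - 1)) i = H.outPair i ↔ i = b₀ := fun i => by
    rw [← Set.mem_singleton_iff (b := b₀), ← hb₀]; rfl
  refine ⟨{q | pairAt q b₀ ∈ H.outProj b₀}, fun w => ?_⟩
  rw [quadForm_outOp, Finset.sum_eq_single b₀]
  · refine Finset.sum_congr rfl fun q _ => ?_
    simp [(hmem b₀).mpr rfl]
  · intro i _ hi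
    refine Finset.sum_eq_zero fun q _ => ?_
    rw [if_neg fun h' => hi ((hmem i).mp h'.1), zero_mul]
  · simp

/-- Undoing the computation turns the energy along a legal evolution into that of a path with input
penalties and with the rejection probability as penalty at its last site. -/
lemma sum_stateEnergy (hγ : H.IsRun T γ) (hD : H.IsDeterministicOn W)
    (hH : H.IsStandardClock a b c T Tinit) (v : (Fin n → Fin C × Fin Q) → ℂ)
    (w : ℕ → Comp n Q → ℂ) (hw : ∀ t < T, block v (γ t) = H.evolve γ t *ᵥ w t) :
    ∑ t ∈ Finset.range T, H.stateEnergy v (γ t) =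
      ∑ q, PathChain.hop (fun t => w t q) (T - 1) +
        ∑ t ∈ Finset.range T, quadForm (H.inOp (γ t)) (w t) + H.rejectProb T γ (w (T - 1)) := by
  obtain ⟨k, rfl⟩ : ∃ k, T = k + 1 := ⟨T - 1, by have := hγ.pos; omega⟩
  have h1 : ∑ t ∈ Finset.range (k + 1), H.transEnergy v (γ t) =
      ∑ q, PathChain.hop (fun t => w t q) (k + 1 - 1) := by
    have hlast := transEnergy_eq_zero_of_no_step v hγ.not_step_last
    rw [Nat.add_sub_cancel] at hlast
    rw [Finset.sum_range_succ, hlast, add_zero, Nat.add_sub_cancel]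
    unfold PathChain.hop
    rw [Finset.sum_comm]
    refine Finset.sum_congr rfl fun t ht => ?_
    have ht' : t + 1 < k + 1 := Nat.succ_lt_succ (Finset.mem_range.mp ht)
    rw [hD.transEnergy_eq (hγ.mem hD (Nat.lt_of_succ_lt ht')) (hγ.step t ht'), hw _ ht',
      hw _ (Nat.lt_of_succ_lt ht'), Matrix.mulVec_mulVec]
    have : H.stepOp (γ t) (γ (t + 1)) * H.evolve γ t = H.evolve γ (t + 1) := rfl
    rw [this, ← Matrix.mulVec_sub, sqNorm_mulVec_of_isometry (hγ.evolve_isometry hD ht'), sqNorm,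
      Finset.mul_sum]
    rfl
  have h2 : ∑ t ∈ Finset.range (k + 1), quadForm (H.outOp (γ t)) (block v (γ t)) =
      H.rejectProb (k + 1) γ (w (k + 1 - 1)) := by
    rw [Finset.sum_range_succ, Finset.sum_eq_zero, zero_add, hw _ (Nat.lt_succ_self k)]
    · rfl
    · intro t ht
      exact hγ.quadForm_outOp_eq_zero hH (Nat.succ_lt_succ (Finset.mem_range.mp ht)) _
  rw [← h1, ← h2]
  simp only [stateEnergy, Finset.sum_add_distrib]
  rw [Finset.sum_congr rfl fun t ht =>
      penEnergy_of_legal v (hγ.legal t (Finset.mem_range.mp ht)), Finset.sum_const_zero, add_zero,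
    Finset.sum_congr (f := fun t => quadForm (H.inOp (γ t)) (block v (γ t))) rfl fun t ht => by
      rw [hw t (Finset.mem_range.mp ht), hγ.quadForm_inOp_evolve hH (Finset.mem_range.mp ht)]]

/-- The history state of a correctly initialised input `φ` with amplitudes `x`. -/
lemma exists_history (hγ : H.IsRun T γ) (hD : H.IsDeterministicOn W)
    (hH : H.IsStandardClock a b c T Tinit) (x : ℕ → ℂ) (φ : Comp n Q → ℂ)
    (hφ : ∀ t < T, H.inOp (γ t) *ᵥ φ = 0) :
    ∃ v, sqNorm v = (∑ t ∈ Finset.range T, ‖x t‖ ^ 2) * sqNorm φ ∧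
      quadForm H.hamiltonian v = PathChain.hop x (T - 1) * sqNorm φ +
        ‖x (T - 1)‖ ^ 2 * H.rejectProb T γ φ := by
  classical
  let u : Clock n C → Comp n Q → ℂ := fun s =>
    ∑ t ∈ Finset.range T, if γ t = s then x t • (H.evolve γ t *ᵥ φ) else 0
  have hu : ∀ t < T, u (γ t) = x t • (H.evolve γ t *ᵥ φ) := by
    intro t ht
    simp only [u]
    rw [Finset.sum_eq_single t]
    · rw [if_pos rfl]
    · intro t' ht' hne
      rw [if_neg fun h => hne (hγ.eq_of_apply_eq hγ hD (Finset.mem_range.mp ht') ht h).1]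
    · exact fun h => absurd (Finset.mem_range.mpr ht) h
  have hu0 : ∀ s, (¬ ∃ t < T, γ t = s) → u s = 0 := fun s hs =>
    Finset.sum_eq_zero fun t ht => if_neg fun h => hs ⟨t, Finset.mem_range.mp ht, h⟩
  have hsum : ∀ f : Clock n C → ℝ, (∀ s, (¬ ∃ t < T, γ t = s) → f s = 0) →
      ∑ s, f s = ∑ t ∈ Finset.range T, f (γ t) := by
    intro f hf
    symm
    refine Finset.sum_of_injOn γ ?_ ?_ ?_ ?_
    · intro t ht t' ht' h
      exact (hγ.eq_of_apply_eq hγ hD (by simpa using ht) (by simpa using ht') h).1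
    · simp
    · rintro s - hs
      refine hf s ?_
      rintro ⟨t, ht, rfl⟩
      exact hs ⟨t, by simpa using ht, rfl⟩
    · intro t _; rfl
  refine ⟨assemble u, ?_, ?_⟩
  · rw [sqNorm_eq_sum_block, hsum, Finset.sum_mul]
    · refine Finset.sum_congr rfl fun t ht => ?_
      rw [Finset.mem_range] at ht
      rw [block_assemble, hu t ht, sqNorm_smul,
        sqNorm_mulVec_of_isometry (hγ.evolve_isometry hD ht)]
    · intro s hs
      rw [block_assemble, hu0 s hs, sqNorm_zero]
  · rw [quadForm_hamiltonian, hsum, hγ.sum_stateEnergy hD hH _ fun t => x t • φ]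
    · have h1 : ∀ q, PathChain.hop (fun t => (x t • φ) q) (T - 1) =
          PathChain.hop x (T - 1) * ‖φ q‖ ^ 2 := by
        intro q
        unfold PathChain.hop
        rw [Finset.sum_mul]
        refine Finset.sum_congr rfl fun t _ => ?_
        simp only [Pi.smul_apply, smul_eq_mul]
        rw [← sub_mul, norm_mul, mul_pow,
          mul_assoc]
      have h2 : ∑ t ∈ Finset.range T, quadForm (H.inOp (γ t)) (x t • φ) = 0 := by
        refine Finset.sum_eq_zero fun t ht => ?_
        rw [quadForm, Matrix.mulVec_smul, hφ t (Finset.mem_range.mp ht), smul_zero,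
          dotProduct_zero, Complex.zero_re]
      have h3 : H.rejectProb T γ (x (T - 1) • φ) = ‖x (T - 1)‖ ^ 2 * H.rejectProb T γ φ := by
        obtain ⟨S, hS⟩ := hγ.exists_quadForm_outOp hH
        have e : ∀ φ, H.rejectProb T γ φ =
            quadForm (H.outOp (γ (T - 1))) (H.evolve γ (T - 1) *ᵥ φ) := fun _ => rfl
        rw [e, e, hS, hS, Finset.mul_sum]
        refine Finset.sum_congr rfl fun q _ => ?_
        rw [Matrix.mulVec_smul, Pi.smul_apply, smul_eq_mul, norm_mul, mul_pow]
        split_ifs <;> simp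
      rw [h2, h3, add_zero, Finset.sum_congr rfl fun q _ => h1 q, ← Finset.mul_sum]
      rfl
    · intro t ht
      rw [block_assemble, hu t ht, Matrix.mulVec_smul]
    · intro s hs
      have hb : block (assemble u) s = 0 := by rw [block_assemble, hu0 s hs]
      have h1 : H.transEnergy (assemble u) s = 0 := by
        refine transEnergy_eq_zero _ (fun s' h' => ?_) hb
        rw [block_assemble]
        refine hu0 s' ?_
        rintro ⟨t, ht, rfl⟩
        exact hs (hγ.exists_of_step_left hD ht h')
      have h2 : H.penEnergy (assemble u) s = 0 :=
        Finset.sum_eq_zero fun i _ => by rw [hb, sqNorm_zero, ite_self]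
      rw [stateEnergy, h1, h2, hb]
      simp [quadForm]

end IsRun

end StandardForm

/-! ### The energy along a legal evolution -/

namespace StandardForm

variable {n C Q : ℕ} {H : StandardForm n C Q}

namespace IsRun

variable {W : Set (Clock n C)} {T Tinit : ℕ} {γ γ' : ℕ → Clock n C} {a b c : ℝ}

/-- The basis states of the computational space on which no input penalty acts along `γ`; they span
the correctly initialised inputs. -/
def Initialised (H : StandardForm n C Q) (T : ℕ) (γ : ℕ → Clock n C) (q : Comp n Q) : Prop :=
  ∀ t < T, ∀ i, pairAt q i ∉ H.inProj i (pairAt (γ t) i)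

lemma inOp_mulVec_eq_zero {φ : Comp n Q → ℂ} (hφ : ∀ q, ¬ Initialised H T γ q → φ q = 0) {t : ℕ}
    (ht : t < T) : H.inOp (γ t) *ᵥ φ = 0 := by
  classical
  funext q
  rw [inOp, Matrix.sum_mulVec, Finset.sum_apply]
  refine Finset.sum_eq_zero fun i _ => ?_
  rw [onPair_diagonal, Matrix.mulVec_diagonal]
  by_cases hq : Initialised H T γ q
  · have hq' : (q i.left, q i.right) ∉ H.inProj i (pairAt (γ t) i) := hq t ht i
    rw [if_neg hq', zero_mul]
  · rw [hφ q hq, mul_zero]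

open Classical in
/-- Coherences between correctly and incorrectly initialised inputs cost at most `ε` in the
rejection probability if the former are accepted with probability at most `ε²`. -/
lemma rejectProb_ge (hγ : H.IsRun T γ) (hD : H.IsDeterministicOn W)
    (hH : H.IsStandardClock a b c T Tinit) {ε : ℝ} (hε : 0 < ε)
    (hrej : ∀ φ : Comp n Q → ℂ, (∀ t < T, H.inOp (γ t) *ᵥ φ = 0) →
      (1 - ε ^ 2) * sqNorm φ ≤ H.rejectProb T γ φ) (w : Comp n Q → ℂ) :
    ∑ q, (if Initialised H T γ q then 1 - (ε + ε ^ 2) else -ε) * ‖w q‖ ^ 2 ≤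
      H.rejectProb T γ w := by
  obtain ⟨S, hS⟩ := hγ.exists_quadForm_outOp hH
  set E := H.evolve γ (T - 1)
  have hE : Eᴴ * E = 1 := hγ.evolve_isometry hD (by have := hγ.pos; omega)
  let acc : (Comp n Q → ℂ) → ℝ := fun φ => ∑ q, if q ∈ S then 0 else ‖(E *ᵥ φ) q‖ ^ 2
  have hacc : ∀ φ, H.rejectProb T γ φ + acc φ = sqNorm φ := by
    intro φ
    have e : H.rejectProb T γ φ = quadForm (H.outOp (γ (T - 1))) (E *ᵥ φ) := rfl
    rw [e, hS, ← sqNorm_mulVec_of_isometry hE φ, sqNorm, ← Finset.sum_add_distrib]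
    exact Finset.sum_congr rfl fun q _ => by split_ifs <;> simp
  have hrejnn : ∀ φ, 0 ≤ H.rejectProb T γ φ := fun φ => H.quadForm_outOp_nonneg _ (E *ᵥ φ)
  set x : Comp n Q → ℂ := fun q => if Initialised H T γ q then w q else 0 with hx
  set y : Comp n Q → ℂ := fun q => if Initialised H T γ q then 0 else w q with hy
  have hxy : w = x + y := by
    funext q
    simp only [hx, hy, Pi.add_apply]
    split_ifs <;> simp
  have hax : acc x ≤ ε ^ 2 * sqNorm x := by
    have := hrej x fun t ht => inOp_mulVec_eq_zero (fun q hq => by simp [hx, hq]) ht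
    linarith [hacc x]
  have hay : acc y ≤ sqNorm y := by linarith [hacc y, hrejnn y]
  -- `|α + β|² ≤ (1 + 1/ε) |α|² + (1 + ε) |β|²` balances the two contributions
  have haw : acc w ≤ (1 + 1 / ε) * acc x + (1 + ε) * acc y := by
    simp only [acc]
    rw [Finset.mul_sum, Finset.mul_sum, ← Finset.sum_add_distrib]
    refine Finset.sum_le_sum fun q _ => ?_
    split_ifs
    · simp
    · rw [hxy, Matrix.mulVec_add, Pi.add_apply]
      have h1 := norm_add_le ((E *ᵥ x) q) ((E *ᵥ y) q)
      have h2 := pow_le_pow_left₀ (norm_nonneg _) h1 2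
      refine h2.trans ?_
      have h3 : (1 + 1 / ε) * ‖(E *ᵥ x) q‖ ^ 2 + (1 + ε) * ‖(E *ᵥ y) q‖ ^ 2 -
          (‖(E *ᵥ x) q‖ + ‖(E *ᵥ y) q‖) ^ 2 =
            (‖(E *ᵥ x) q‖ - ε * ‖(E *ᵥ y) q‖) ^ 2 / ε := by
        field_simp
        ring
      have h4 : 0 ≤ (‖(E *ᵥ x) q‖ - ε * ‖(E *ᵥ y) q‖) ^ 2 / ε := by positivity
      linarith
  have hsum : sqNorm w = sqNorm x + sqNorm y := by
    simp only [sqNorm]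
    rw [← Finset.sum_add_distrib]
    refine Finset.sum_congr rfl fun q _ => ?_
    simp only [hx, hy]
    split_ifs <;> simp
  have hL : ∑ q, (if Initialised H T γ q then 1 - (ε + ε ^ 2) else -ε) * ‖w q‖ ^ 2 =
      (1 - (ε + ε ^ 2)) * sqNorm x + -ε * sqNorm y := by
    simp only [sqNorm]
    rw [Finset.mul_sum, Finset.mul_sum, ← Finset.sum_add_distrib]
    refine Finset.sum_congr rfl fun q _ => ?_
    simp only [hx, hy]
    split_ifs <;> simp
  have h1 : (1 + 1 / ε) * acc x ≤ (1 + 1 / ε) * (ε ^ 2 * sqNorm x) :=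
    mul_le_mul_of_nonneg_left hax (by positivity)
  have h2 : (1 + ε) * acc y ≤ (1 + ε) * sqNorm y := mul_le_mul_of_nonneg_left hay (by positivity)
  have h3 : (1 + 1 / ε) * (ε ^ 2 * sqNorm x) = (ε + ε ^ 2) * sqNorm x := by
    field_simp
    ring
  rw [hL]
  linarith [hacc w]

/-- Along a legal evolution, the energy is at least that of a chain with a unit penalty at an end,
up to the error `ε`. -/
lemma sum_stateEnergy_ge (hγ : H.IsRun T γ) (hD : H.IsDeterministicOn W)
    (hH : H.IsStandardClock a b c T Tinit) {ε : ℝ} (hε : 0 < ε)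
    (hεE : ε ≤ 1 - Real.cos (Real.pi / (2 * T))) (hE : 1 - Real.cos (Real.pi / (2 * T)) ≤ 1 / 2)
    (hinit : ∀ t ≤ Tinit, 1 / 2 ≤ PathChain.wave (Real.pi / (2 * T)) t)
    (hrej : ∀ φ : Comp n Q → ℂ, (∀ t < T, H.inOp (γ t) *ᵥ φ = 0) →
      (1 - ε ^ 2) * sqNorm φ ≤ H.rejectProb T γ φ) (v : (Fin n → Fin C × Fin Q) → ℂ) :
    (1 - Real.cos (Real.pi / (2 * T)) - ε) * ∑ t ∈ Finset.range T, sqNorm (block v (γ t)) ≤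
      ∑ t ∈ Finset.range T, H.stateEnergy v (γ t) := by
  classical
  have hT := hγ.pos
  set w : ℕ → Comp n Q → ℂ := fun t => (H.evolve γ t)ᴴ *ᵥ block v (γ t) with hw
  have hw' : ∀ t < T, block v (γ t) = H.evolve γ t *ᵥ w t := by
    intro t ht
    rw [hw, Matrix.mulVec_mulVec, mul_eq_one_comm.mp (hγ.evolve_isometry hD ht),
      Matrix.one_mulVec]
  have hN : ∑ t ∈ Finset.range T, sqNorm (block v (γ t)) =
      ∑ q, ∑ t ∈ Finset.range T, ‖w t q‖ ^ 2 := by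
    rw [Finset.sum_comm]
    refine Finset.sum_congr rfl fun t ht => ?_
    rw [Finset.mem_range] at ht
    rw [hw' t ht, sqNorm_mulVec_of_isometry (hγ.evolve_isometry hD ht), sqNorm]
  have hin : ∑ t ∈ Finset.range T, quadForm (H.inOp (γ t)) (w t) =
      ∑ q, ∑ t ∈ Finset.range T, ∑ i : Bond n,
        (if pairAt q i ∈ H.inProj i (pairAt (γ t) i) then 1 else 0) * ‖w t q‖ ^ 2 := by
    simp only [quadForm_inOp]
    rw [Finset.sum_comm (s := (Finset.univ : Finset (Comp n Q)))]
    refine Finset.sum_congr rfl fun t _ => ?_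
    rw [Finset.sum_comm]
  have hr := hγ.rejectProb_ge hD hH hε hrej (w (T - 1))
  rw [hγ.sum_stateEnergy hD hH v w hw', hN, hin, Finset.mul_sum]
  refine le_trans ?_ (add_le_add_right hr _)
  rw [← Finset.sum_add_distrib, ← Finset.sum_add_distrib]
  refine Finset.sum_le_sum fun q _ => ?_
  set E₀ := 1 - Real.cos (Real.pi / (2 * T))
  set N := ∑ t ∈ Finset.range T, ‖w t q‖ ^ 2
  have hN0 : 0 ≤ N := Finset.sum_nonneg fun _ _ => by positivity
  have hIn0 : ∀ t, 0 ≤ ∑ i : Bond n,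
      (if pairAt q i ∈ H.inProj i (pairAt (γ t) i) then 1 else 0) * ‖w t q‖ ^ 2 := fun t =>
    Finset.sum_nonneg fun i _ => by split_ifs <;> positivity
  by_cases hq : Initialised H T γ q
  · rw [if_pos hq]
    have h1 := PathChain.energy_ge_of_penalty_last hT fun t => w t q
    have h2 : 0 ≤ ∑ t ∈ Finset.range T, ∑ i : Bond n,
        (if pairAt q i ∈ H.inProj i (pairAt (γ t) i) then 1 else 0) * ‖w t q‖ ^ 2 :=
      Finset.sum_nonneg fun t _ => hIn0 t
    have h3 := PathChain.hop_nonneg (fun t => w t q) (T - 1)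
    have hβ0 : 0 ≤ ε + ε ^ 2 := by positivity
    have hβ1 : ε + ε ^ 2 ≤ 1 := by nlinarith
    -- the penalty `1 - β` still gives `(1 - β) E₀ ≥ E₀ - ε`, as `E₀ ≤ 1/2`
    have h4 : (ε + ε ^ 2) * E₀ ≤ ε := by nlinarith
    have h5 : (1 - (ε + ε ^ 2)) * (E₀ * N) ≤ (1 - (ε + ε ^ 2)) *
        (PathChain.hop (fun t => w t q) (T - 1) + ‖w (T - 1) q‖ ^ 2) :=
      mul_le_mul_of_nonneg_left h1 (by linarith)
    have h6 : 0 ≤ (ε - (ε + ε ^ 2) * E₀) * N := mul_nonneg (by linarith) hN0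
    have h7 : 0 ≤ (ε + ε ^ 2) * PathChain.hop (fun t => w t q) (T - 1) := mul_nonneg hβ0 h3
    nlinarith
  · rw [if_neg hq]
    simp only [Initialised, not_forall, not_not] at hq
    obtain ⟨t₀, ht₀, i₀, hi₀⟩ := hq
    have hti := hH.in_init γ hγ t₀ ht₀ i₀ ⟨_, hi₀⟩
    have h1 := PathChain.energy_ge_of_penalty_at hT (fun t => w t q) ht₀ (hinit t₀ hti)
    have h2 : ‖w t₀ q‖ ^ 2 ≤ ∑ t ∈ Finset.range T, ∑ i : Bond n,
        (if pairAt q i ∈ H.inProj i (pairAt (γ t) i) then 1 else 0) * ‖w t q‖ ^ 2 := by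
      refine le_trans ?_ (Finset.single_le_sum (fun t _ => hIn0 t) (Finset.mem_range.mpr ht₀))
      refine le_trans ?_ (Finset.single_le_sum (fun i _ => ?_) (Finset.mem_univ i₀))
      · rw [if_pos hi₀, one_mul]
      · split_ifs <;> positivity
    have h3 : ‖w (T - 1) q‖ ^ 2 ≤ N :=
      Finset.single_le_sum (f := fun t => ‖w t q‖ ^ 2) (fun t _ => by positivity)
        (Finset.mem_range.mpr (by omega))
    have h4 := mul_le_mul_of_nonneg_left h3 hε.le
    linarith

lemma apply_eq_of_zero_eq (hγ : H.IsRun T γ) (hγ' : H.IsRun T γ') (hD : H.IsDeterministicOn W)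
    (h : γ 0 = γ' 0) : ∀ {t : ℕ}, t < T → γ t = γ' t
  | 0, _ => h
  | t + 1, ht => by
    have ih := apply_eq_of_zero_eq hγ hγ' hD h (Nat.lt_of_succ_lt ht)
    exact hD.step_right_unique (hγ.mem hD (Nat.lt_of_succ_lt ht)) (hγ.step t ht)
      (ih ▸ hγ'.step t ht)

end IsRun

/-- The clock states that occur in legal evolutions of length `T`. -/
def runStates (H : StandardForm n C Q) (T : ℕ) : Set (Clock n C) :=
  {s | ∃ γ, H.IsRun T γ ∧ ∃ t < T, γ t = s}

open Classical in
/-- The clock states of legal evolutions are the disjoint union of the individual evolutions. -/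
lemma sum_runStates_nonneg {W : Set (Clock n C)} (hD : H.IsDeterministicOn W) {T : ℕ}
    (F : Clock n C → ℝ) (hF : ∀ γ, H.IsRun T γ → 0 ≤ ∑ t ∈ Finset.range T, F (γ t)) :
    0 ≤ ∑ s ∈ Finset.univ.filter (· ∈ H.runStates T), F s := by
  let S₀ : Finset (Clock n C) := Finset.univ.filter fun s => ∃ γ, H.IsRun T γ ∧ γ 0 = s
  have hS₀ : ∀ s : Clock n C, ∃ γ, s ∈ S₀ → H.IsRun T γ ∧ γ 0 = s := by
    intro s
    by_cases hs : s ∈ S₀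
    · obtain ⟨γ, hγ⟩ := (Finset.mem_filter.mp hs).2
      exact ⟨γ, fun _ => hγ⟩
    · exact ⟨fun _ => s, fun h => absurd h hs⟩
  choose g hg using hS₀
  have key : ∑ s ∈ Finset.univ.filter (· ∈ H.runStates T), F s =
      ∑ p ∈ S₀ ×ˢ Finset.range T, F (g p.1 p.2) := by
    symm
    refine Finset.sum_nbij (fun p => g p.1 p.2) ?_ ?_ ?_ fun _ _ => rfl
    · rintro ⟨s, t⟩ hp
      obtain ⟨h1, h2⟩ := Finset.mem_product.mp hp
      exact Finset.mem_filter.mpr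
        ⟨Finset.mem_univ _, g s, (hg s h1).1, t, Finset.mem_range.mp h2, rfl⟩
    · rintro ⟨s, t⟩ hp ⟨s', t'⟩ hp' h
      obtain ⟨h1, h2⟩ := Finset.mem_product.mp (Finset.mem_coe.mp hp)
      obtain ⟨h1', h2'⟩ := Finset.mem_product.mp (Finset.mem_coe.mp hp')
      have := (hg s h1).1.eq_of_apply_eq (hg s' h1').1 hD (Finset.mem_range.mp h2)
        (Finset.mem_range.mp h2') h
      rw [(hg s h1).2, (hg s' h1').2] at this
      exact Prod.ext this.2 this.1
    · intro s hs
      obtain ⟨γ, hγ, t, ht, rfl⟩ := (Finset.mem_filter.mp (Finset.mem_coe.mp hs)).2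
      have h0 : γ 0 ∈ S₀ := Finset.mem_filter.mpr ⟨Finset.mem_univ _, γ, hγ, rfl⟩
      refine ⟨(γ 0, t), Finset.mem_coe.mpr (Finset.mem_product.mpr
        ⟨h0, Finset.mem_range.mpr ht⟩), ?_⟩
      exact (hg _ h0).1.apply_eq_of_zero_eq hγ hD (hg _ h0).2 ht
  rw [key, Finset.sum_product]
  exact Finset.sum_nonneg fun s hs => hF _ (hg s hs).1

/-! ### The energy of the remaining clock states -/

lemma sqrt_sqNorm_le {ι : Type*} [Fintype ι] (u w : ι → ℂ) :
    Real.sqrt (sqNorm u) ≤ Real.sqrt (sqNorm w) + Real.sqrt (sqNorm (w - u)) := by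
  simp only [sqNorm_eq_norm, Real.sqrt_sq (norm_nonneg _), WithLp.toLp_sub]
  rw [norm_sub_rev]
  exact norm_le_norm_add_norm_sub' _ _

/-- The norms of neighbouring components differ by at most the root of twice the energy. -/
lemma IsDeterministicOn.sqrt_sqNorm_step {W : Set (Clock n C)} (hD : H.IsDeterministicOn W)
    {s s' : Clock n C} (hs : s ∈ W) (h : H.Step s s') (v : (Fin n → Fin C × Fin Q) → ℂ) :
    Real.sqrt (sqNorm (block v s)) ≤
        Real.sqrt (sqNorm (block v s')) + Real.sqrt (2 * H.stateEnergy v s) ∧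
      Real.sqrt (sqNorm (block v s')) ≤
        Real.sqrt (sqNorm (block v s)) + Real.sqrt (2 * H.stateEnergy v s) := by
  have h1 : sqNorm (block v s' - H.stepOp s s' *ᵥ block v s) ≤ 2 * H.stateEnergy v s := by
    have := H.transEnergy_le_stateEnergy v s
    rw [hD.transEnergy_eq hs h] at this
    linarith
  have h2 := Real.sqrt_le_sqrt h1
  have h3 := sqNorm_mulVec_of_isometry (hD.stepOp_isometry hs h) (block v s)
  have h4 := sqrt_sqNorm_le (H.stepOp s s' *ᵥ block v s) (block v s')
  have h5 := sqrt_sqNorm_le (block v s') (H.stepOp s s' *ᵥ block v s)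
  have h6 : sqNorm (H.stepOp s s' *ᵥ block v s - block v s') =
      sqNorm (block v s' - H.stepOp s s' *ᵥ block v s) := by
    simp only [sqNorm, Pi.sub_apply, norm_sub_rev]
  rw [h3] at h4 h5
  rw [h6] at h5
  exact ⟨by linarith, by linarith⟩

/-- A component that is connected with an illegal clock state is bounded by the energies of the
clock states on the way. -/
lemma IsDeterministicOn.sqNorm_le_sum_path {W : Set (Clock n C)} (hD : H.IsDeterministicOn W)
    (v : (Fin n → Fin C × Fin Q) → ℂ) {f : ℕ → Clock n C} {m : ℕ} (h0 : f 0 ∈ W)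
    (hm : ¬ H.Legal (f m))
    (hf : (∀ j < m, H.Step (f j) (f (j + 1))) ∨ (∀ j < m, H.Step (f (j + 1)) (f j))) :
    sqNorm (block v (f 0)) ≤
      8 * (m + 1) * ∑ j ∈ Finset.range (m + 1), H.stateEnergy v (f j) := by
  have hW : ∀ j ≤ m, f j ∈ W := by
    intro j hj
    induction j with
    | zero => exact h0
    | succ j ih =>
      rcases hf with hf | hf
      · exact (hD.closed _ _ (hf j hj)).mp (ih (Nat.le_of_succ_le hj))
      · exact (hD.closed _ _ (hf j hj)).mpr (ih (Nat.le_of_succ_le hj))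
  set r : ℕ → ℝ := fun j => Real.sqrt (sqNorm (block v (f j))) with hr
  set g : ℕ → ℝ := fun j => Real.sqrt (2 * H.stateEnergy v (f j)) with hg
  have hg0 : ∀ j, 0 ≤ g j := fun j => Real.sqrt_nonneg _
  have hstep : ∀ j < m, r j ≤ r (j + 1) + (g j + g (j + 1)) := by
    intro j hj
    have := hg0 j
    have := hg0 (j + 1)
    rcases hf with hf | hf
    · have := (hD.sqrt_sqNorm_step (hW j hj.le) (hf j hj) v).1
      simp only [hr, hg] at *
      linarith
    · have := (hD.sqrt_sqNorm_step (hW (j + 1) hj) (hf j hj) v).2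
      simp only [hr, hg] at *
      linarith
  have hind : ∀ k ≤ m, r 0 + g k ≤ r k + 2 * ∑ j ∈ Finset.range (k + 1), g j := by
    intro k hk
    induction k with
    | zero => have := hg0 0; simp only [Finset.sum_range_one, zero_add]; linarith
    | succ k ih =>
      rw [Finset.sum_range_succ]
      have := ih (Nat.le_of_succ_le hk)
      have := hstep k hk
      linarith
  have hlast : r m ≤ g m := by
    refine Real.sqrt_le_sqrt ?_
    have := sqNorm_le_stateEnergy_of_not_legal v hm
    have := H.stateEnergy_nonneg v (f m)
    linarith
  have hmain : r 0 ≤ 2 * ∑ j ∈ Finset.range (m + 1), g j := by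
    have := hind m le_rfl
    linarith
  have hsq : (∑ j ∈ Finset.range (m + 1), g j) ^ 2 ≤
      ((m : ℝ) + 1) * ∑ j ∈ Finset.range (m + 1), g j ^ 2 := by
    have := sq_sum_le_card_mul_sum_sq (s := Finset.range (m + 1)) (f := g)
    rw [Finset.card_range] at this
    exact_mod_cast this
  have hg2 : ∑ j ∈ Finset.range (m + 1), g j ^ 2 =
      2 * ∑ j ∈ Finset.range (m + 1), H.stateEnergy v (f j) := by
    rw [Finset.mul_sum]
    refine Finset.sum_congr rfl fun j _ => ?_
    exact Real.sq_sqrt (mul_nonneg (by norm_num) (H.stateEnergy_nonneg v _))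
  have hr0 : r 0 ^ 2 = sqNorm (block v (f 0)) := Real.sq_sqrt (sqNorm_nonneg _)
  have h9 := pow_le_pow_left₀ (Real.sqrt_nonneg _ : 0 ≤ r 0) hmain 2
  rw [hg2] at hsq
  rw [← hr0]
  nlinarith

/-- If paths of length at most `M` follow a relation that is injective on `W`, every clock state is
visited at most `M + 1` times. -/
lemma sum_paths_le {W : Set (Clock n C)} {R : Finset (Clock n C)}
    (rel : Clock n C → Clock n C → Prop) (hclosed : ∀ s s', rel s s' → (s ∈ W ↔ s' ∈ W))
    (hinj : ∀ s s' s'', s ∈ W → rel s' s → rel s'' s → s' = s'')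
    (hR : ∀ s s', rel s s' → s ∈ R → s' ∈ R) (e : Clock n C → ℝ) (he : ∀ s, 0 ≤ e s)
    (L : Finset (Clock n C)) (hLR : L ⊆ R) (hLW : ∀ s ∈ L, s ∈ W) (f : Clock n C → ℕ → Clock n C)
    (m : Clock n C → ℕ) (M : ℕ) (hm : ∀ s ∈ L, m s ≤ M) (h0 : ∀ s ∈ L, f s 0 = s)
    (hf : ∀ s ∈ L, ∀ j < m s, rel (f s j) (f s (j + 1))) :
    ∑ s ∈ L, ∑ j ∈ Finset.range (m s + 1), e (f s j) ≤ (M + 1) * ∑ s ∈ R, e s := by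
  classical
  have hWR : ∀ s ∈ L, ∀ j ≤ m s, f s j ∈ W ∧ f s j ∈ R := by
    intro s hs j hj
    induction j with
    | zero => rw [h0 s hs]; exact ⟨hLW s hs, hLR hs⟩
    | succ j ih =>
      have ih := ih (Nat.le_of_succ_le hj)
      have h1 := hf s hs j hj
      exact ⟨(hclosed _ _ h1).mp ih.1, hR _ _ h1 ih.2⟩
  have hinj' : ∀ s ∈ L, ∀ s' ∈ L, ∀ j, j ≤ m s → j ≤ m s' → f s j = f s' j → s = s' := by
    intro s hs s' hs' j
    induction j with
    | zero => intro _ _ h; rwa [h0 s hs, h0 s' hs'] at h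
    | succ j ih =>
      intro hj hj' h
      refine ih (Nat.le_of_succ_le hj) (Nat.le_of_succ_le hj') ?_
      exact hinj _ _ _ (hWR s hs (j + 1) hj).1 (hf s hs j hj) (h ▸ hf s' hs' j hj')
  calc ∑ s ∈ L, ∑ j ∈ Finset.range (m s + 1), e (f s j)
      = ∑ s ∈ L, ∑ j ∈ Finset.range (M + 1), if j ≤ m s then e (f s j) else 0 := by
        refine Finset.sum_congr rfl fun s hs => ?_
        rw [← Finset.sum_filter]
        refine Finset.sum_congr ?_ fun _ _ => rfl
        ext j
        have := hm s hs
        simp only [Finset.mem_range, Finset.mem_filter]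
        omega
    _ = ∑ j ∈ Finset.range (M + 1), ∑ s ∈ L.filter (fun s => j ≤ m s), e (f s j) := by
        rw [Finset.sum_comm]
        exact Finset.sum_congr rfl fun j _ => (Finset.sum_filter _ _).symm
    _ ≤ ∑ j ∈ Finset.range (M + 1), ∑ s ∈ R, e s := by
        refine Finset.sum_le_sum fun j _ => ?_
        rw [← Finset.sum_image (f := e) (g := fun s => f s j)]
        · refine Finset.sum_le_sum_of_subset_of_nonneg ?_ fun s _ _ => he s
          intro s hs
          obtain ⟨s', hs', rfl⟩ := Finset.mem_image.mp hs
          obtain ⟨h1, h2⟩ := Finset.mem_filter.mp hs'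
          exact (hWR s' h1 j h2).2
        · intro s hs s' hs' h
          obtain ⟨h1, h2⟩ := Finset.mem_filter.mp (Finset.mem_coe.mp hs)
          obtain ⟨h1', h2'⟩ := Finset.mem_filter.mp (Finset.mem_coe.mp hs')
          exact hinj' s h1 s' h1' j h2 h2' h
    _ = (M + 1) * ∑ s ∈ R, e s := by
        rw [Finset.sum_const, Finset.card_range, nsmul_eq_mul]
        push_cast
        rfl

open Classical in
/-- Outside the legal evolutions, the energy per clock state is of the order of the inverse square
of the distance to illegal clock states. -/
lemma sum_rest_sqNorm_le {W : Set (Clock n C)} (hD : H.IsDeterministicOn W) {a b c : ℝ}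
    {T Tinit : ℕ} (hH : H.IsStandardClock a b c T Tinit) (v : (Fin n → Fin C × Fin Q) → ℂ) :
    ∑ s ∈ Finset.univ.filter (· ∉ H.runStates T), sqNorm (block v s) ≤
      17 * ((⌊b * n⌋₊ : ℝ) + 1) ^ 2 *
        ∑ s ∈ Finset.univ.filter (· ∉ H.runStates T), H.stateEnergy v s := by
  set M := ⌊b * n⌋₊ with hM
  set R : Finset (Clock n C) := Finset.univ.filter (· ∉ H.runStates T) with hR
  have hmemR : ∀ s, s ∈ R ↔ s ∉ H.runStates T := fun s => by simp [hR]
  set L := R.filter fun s => H.Legal s with hL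
  set X := ∑ s ∈ R, H.stateEnergy v s with hX
  have hX0 : 0 ≤ X := Finset.sum_nonneg fun s _ => H.stateEnergy_nonneg v s
  have hpath : ∀ s : Clock n C, ∃ (f : ℕ → Clock n C) (m : ℕ), s ∈ L →
      (m ≤ M ∧ f 0 = s ∧ ¬ H.Legal (f m) ∧
        ((∀ j < m, H.Step (f j) (f (j + 1))) ∨ (∀ j < m, H.Step (f (j + 1)) (f j)))) := by
    intro s
    by_cases hs : s ∈ L
    · obtain ⟨h1, h2⟩ := Finset.mem_filter.mp hs
      rw [hmemR] at h1
      have h3 : ¬ ∀ s', H.SameBlock s s' → H.Legal s' := fun h => h1 (hH.legal_block s h)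
      simp only [not_forall] at h3
      obtain ⟨s', h4, h5⟩ := h3
      obtain ⟨f, m, h6, h7⟩ := hH.evolve_illegal s s' h2 h4 h5
      exact ⟨f, m, fun _ => ⟨Nat.le_floor h6, h7⟩⟩
    · exact ⟨fun _ => s, 0, fun h => absurd h hs⟩
  choose f m hfm using hpath
  have hLW : ∀ s ∈ L, s ∈ W := fun s hs => hD.mem_of_legal s (Finset.mem_filter.mp hs).2
  -- legal states whose path runs forwards, and the others
  set L₁ := L.filter fun s => ∀ j < m s, H.Step (f s j) (f s (j + 1)) with hL₁
  set L₂ := L.filter fun s => ¬ ∀ j < m s, H.Step (f s j) (f s (j + 1)) with hL₂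
  have hsub₁ : L₁ ⊆ L := Finset.filter_subset _ _
  have hsub₂ : L₂ ⊆ L := Finset.filter_subset _ _
  have hsubL : L ⊆ R := Finset.filter_subset _ _
  have h1 : ∑ s ∈ L₁, ∑ j ∈ Finset.range (m s + 1), H.stateEnergy v (f s j) ≤ (M + 1) * X := by
    refine sum_paths_le (W := W) H.Step hD.closed
      (fun s s' s'' hs h' h'' => hD.step_left_unique hs h' h'') ?_ _ (H.stateEnergy_nonneg v) L₁
      (hsub₁.trans hsubL) (fun s hs => hLW s (hsub₁ hs)) f m M
      (fun s hs => (hfm s (hsub₁ hs)).1) (fun s hs => (hfm s (hsub₁ hs)).2.1)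
      (fun s hs => (Finset.mem_filter.mp hs).2)
    intro s s' hstep hs
    rw [hmemR] at hs ⊢
    rintro ⟨γ, hγ, t, ht, rfl⟩
    obtain ⟨t', ht', h'⟩ := hγ.exists_of_step_left hD ht hstep
    exact hs ⟨γ, hγ, t', ht', h'⟩
  have h2 : ∑ s ∈ L₂, ∑ j ∈ Finset.range (m s + 1), H.stateEnergy v (f s j) ≤ (M + 1) * X := by
    refine sum_paths_le (W := W) (fun s s' => H.Step s' s) (fun s s' h => (hD.closed s' s h).symm)
      (fun s s' s'' hs h' h'' => hD.step_right_unique hs h' h'') ?_ _ (H.stateEnergy_nonneg v) L₂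
      (hsub₂.trans hsubL) (fun s hs => hLW s (hsub₂ hs)) f m M
      (fun s hs => (hfm s (hsub₂ hs)).1) (fun s hs => (hfm s (hsub₂ hs)).2.1)
      (fun s hs => ((hfm s (hsub₂ hs)).2.2.2).resolve_left (Finset.mem_filter.mp hs).2)
    intro s s' hstep hs
    rw [hmemR] at hs ⊢
    rintro ⟨γ, hγ, t, ht, rfl⟩
    obtain ⟨t', ht', h'⟩ := hγ.exists_of_step_right hD ht hstep
    exact hs ⟨γ, hγ, t', ht', h'⟩
  have h3 : ∑ s ∈ L, sqNorm (block v s) ≤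
      8 * (M + 1) * ∑ s ∈ L, ∑ j ∈ Finset.range (m s + 1), H.stateEnergy v (f s j) := by
    rw [Finset.mul_sum]
    refine Finset.sum_le_sum fun s hs => ?_
    obtain ⟨hm, h0, hill, hdir⟩ := hfm s hs
    have := hD.sqNorm_le_sum_path v (by rw [h0]; exact hLW s hs) hill hdir
    rw [h0] at this
    refine this.trans (mul_le_mul_of_nonneg_right ?_
      (Finset.sum_nonneg fun j _ => H.stateEnergy_nonneg v _))
    have : (m s : ℝ) ≤ M := by exact_mod_cast hm
    linarith
  have h4 : ∑ s ∈ L, ∑ j ∈ Finset.range (m s + 1), H.stateEnergy v (f s j) ≤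
      2 * ((M + 1) * X) := by
    rw [← Finset.sum_filter_add_sum_filter_not L fun s => ∀ j < m s, H.Step (f s j) (f s (j + 1))]
    linarith
  have h5 : ∑ s ∈ R.filter (fun s => ¬ H.Legal s), sqNorm (block v s) ≤ X :=
    (Finset.sum_le_sum fun s hs =>
      sqNorm_le_stateEnergy_of_not_legal v (Finset.mem_filter.mp hs).2).trans
      (Finset.sum_le_sum_of_subset_of_nonneg (Finset.filter_subset _ _)
        fun s _ _ => H.stateEnergy_nonneg v s)
  rw [← Finset.sum_filter_add_sum_filter_not R fun s => H.Legal s]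
  have hM0 : (0 : ℝ) ≤ M := Nat.cast_nonneg M
  have h6 := mul_le_mul_of_nonneg_left h4 (show (0 : ℝ) ≤ 8 * (M + 1) by positivity)
  have h7 : X ≤ ((M : ℝ) + 1) ^ 2 * X := by
    have : (1 : ℝ) ≤ ((M : ℝ) + 1) ^ 2 := by nlinarith
    nlinarith
  calc _ ≤ 8 * ((M : ℝ) + 1) * (2 * ((M + 1) * X)) + ((M : ℝ) + 1) ^ 2 * X := by linarith
    _ = 17 * ((M : ℝ) + 1) ^ 2 * X := by ring

end StandardForm

/-! ### Ground state energies -/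

lemma quadForm_of_mulVec_eq {ι : Type*} [Fintype ι] {M : Matrix ι ι ℂ} {v : ι → ℂ} {e : ℝ}
    (h : M *ᵥ v = (e : ℂ) • v) : quadForm M v = e * sqNorm v := by
  rw [quadForm, h, dotProduct_smul, ← sqNorm_eq_dotProduct, smul_eq_mul, ← Complex.ofReal_mul,
    Complex.ofReal_re]

/-- The variational principle. -/
lemma exists_isGroundEnergy {ι : Type*} [Fintype ι] [Nonempty ι] {M : Matrix ι ι ℂ}
    (hM : M.IsHermitian) (hpos : ∀ v, 0 ≤ quadForm M v) :
    ∃ E : ℝ, IsGroundEnergy M E ∧ (∀ v, E * sqNorm v ≤ quadForm M v) ∧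
      ∀ e : ℝ, (∀ v, e * sqNorm v ≤ quadForm M v) → e ≤ E := by
  classical
  have hsym := Matrix.isSymmetric_toEuclideanLin_iff.mpr hM
  have heig := hsym.hasEigenvalue_iInf_of_finiteDimensional
  have hquad : ∀ x : EuclideanSpace ℂ ι,
      RCLike.re (inner ℂ (Matrix.toEuclideanLin M x) x) = quadForm M x.ofLp := by
    intro x
    rw [hsym x x]
    simp [EuclideanSpace.inner_eq_star_dotProduct, quadForm, dotProduct_comm]
  set E : ℝ := ⨅ x : { x : EuclideanSpace ℂ ι // x ≠ 0 },
    RCLike.re (inner ℂ (Matrix.toEuclideanLin M x) (x : EuclideanSpace ℂ ι)) /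
      ‖(x : EuclideanSpace ℂ ι)‖ ^ 2 with hE
  obtain ⟨x, hx⟩ := heig.exists_hasEigenvector
  have hx1 : M *ᵥ x.ofLp = (E : ℂ) • x.ofLp := by
    have := congrArg WithLp.ofLp hx.apply_eq_smul
    simpa using this
  have hx0 : x.ofLp ≠ 0 := fun h => hx.2 (by ext i; exact congrFun h i)
  have hle : ∀ v, E * sqNorm v ≤ quadForm M v := by
    intro v
    by_cases hv : v = 0
    · subst hv; simp [quadForm]
    · have hv' : (WithLp.toLp 2 v : EuclideanSpace ℂ ι) ≠ 0 := fun h => hv (by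
        simpa using congrArg WithLp.ofLp h)
      have hbdd : BddBelow (Set.range fun x : { x : EuclideanSpace ℂ ι // x ≠ 0 } =>
          RCLike.re (inner ℂ (Matrix.toEuclideanLin M x) (x : EuclideanSpace ℂ ι)) /
            ‖(x : EuclideanSpace ℂ ι)‖ ^ 2) := by
        refine ⟨0, ?_⟩
        rintro _ ⟨x, rfl⟩
        simp only [hquad]
        exact div_nonneg (hpos _) (sq_nonneg _)
      have h1 := ciInf_le hbdd ⟨WithLp.toLp 2 v, hv'⟩
      rw [← hE] at h1
      simp only [hquad] at h1
      rw [← sqNorm_eq_norm, le_div_iff₀ (sqNorm_pos hv)] at h1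
      exact h1
  refine ⟨E, ⟨⟨x.ofLp, hx0, hx1⟩, ?_⟩, hle, ?_⟩
  · rintro e ⟨v, hv, hev⟩
    have := hle v
    rw [quadForm_of_mulVec_eq hev] at this
    exact le_of_mul_le_mul_right this (sqNorm_pos hv)
  · intro e he
    have := he x.ofLp
    rw [quadForm_of_mulVec_eq hx1] at this
    exact le_of_mul_le_mul_right this (sqNorm_pos hx0)

namespace StandardForm

variable {n C Q : ℕ} {H : StandardForm n C Q}

lemma isHermitian_hamiltonian (H : StandardForm n C Q) : H.hamiltonian.IsHermitian := by
  classical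
  rw [Matrix.IsHermitian, hamiltonian, Matrix.conjTranspose_sum]
  refine Finset.sum_congr rfl fun b _ => ?_
  rw [onPair_conjTranspose]
  congr 1
  have hd : ∀ (P : Two C Q → Prop) [DecidablePred P],
      (Matrix.diagonal fun p => if P p then (1 : ℂ) else 0)ᴴ =
        Matrix.diagonal fun p => if P p then (1 : ℂ) else 0 := by
    intro P _
    rw [Matrix.diagonal_conjTranspose]
    congr 1
    funext p
    simp only [Pi.star_apply]
    split_ifs <;> simp
  have ht : (H.hTrans b)ᴴ = H.hTrans b := by
    rw [hTrans, Matrix.conjTranspose_sum]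
    refine Finset.sum_congr rfl fun ab _ => ?_
    rw [Matrix.conjTranspose_sum]
    refine Finset.sum_congr rfl fun cd _ => ?_
    cases H.rule b ab cd with
    | none => simp
    | some U =>
      simp only [Matrix.conjTranspose_smul, Matrix.conjTranspose_mul,
        Matrix.conjTranspose_conjTranspose]
      congr 1
      simp
  have hp : (H.hPen b)ᴴ = H.hPen b := hd fun p => p.cl ∈ H.illegal b
  have hi : (H.hIn b)ᴴ = H.hIn b := hd fun p => p.qu ∈ H.inProj b p.cl
  have ho : (H.hOut b)ᴴ = H.hOut b := hd fun p => p.cl = H.outPair b ∧ p.qu ∈ H.outProj b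
  rw [Matrix.conjTranspose_add, Matrix.conjTranspose_add, Matrix.conjTranspose_add, ht, hp, hi, ho]

lemma quadForm_hamiltonian_nonneg (H : StandardForm n C Q)
    (v : (Fin n → Fin C × Fin Q) → ℂ) : 0 ≤ quadForm H.hamiltonian v := by
  rw [quadForm_hamiltonian]
  exact Finset.sum_nonneg fun s _ => H.stateEnergy_nonneg v s

/-! ### The spectrum of a standard-form Hamiltonian -/

/-- For long chains the initialisation takes place in the first part of a legal evolution, and
clock states outside the legal evolutions have much more energy than a legal evolution. -/
lemma IsStandardClock.asymptotics {a b c : ℝ} {T Tinit : ℕ} (hb : 0 < b)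
    (hH : H.IsStandardClock a b c T Tinit) (hn1 : 1 ≤ n) (hnb : 6 * (b + 1) ≤ a * n)
    (hnc : 2 * (c + 1) ≤ a * n) :
    1 - Real.cos (Real.pi / (2 * T)) ≤ 1 / 2 ∧
      (∀ t ≤ Tinit, 1 / 2 ≤ PathChain.wave (Real.pi / (2 * T)) t) ∧
      17 * ((⌊b * n⌋₊ : ℝ) + 1) ^ 2 * (1 - Real.cos (Real.pi / (2 * T))) ≤ 1 := by
  have hn : (1 : ℝ) ≤ n := by exact_mod_cast hn1
  have hT := hH.runtime
  have hTb : 6 * (b + 1) * n ≤ T := by nlinarith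
  have hTc : 2 * (c + 1) * n ≤ T := by nlinarith
  have hT2 : (2 : ℝ) ≤ T := by nlinarith
  have hTpos : (0 : ℝ) < T := by linarith
  have hpi := Real.pi_pos
  have hθ : Real.pi / (2 * T) * T = Real.pi / 2 := by field_simp
  set θ := Real.pi / (2 * T)
  have hθ0 : 0 < θ := by positivity
  have hE : (1 - Real.cos θ) * (T : ℝ) ^ 2 ≤ 2 := by
    have h1 := Real.one_sub_sq_div_two_le_cos (x := θ)
    have h2 : (1 - Real.cos θ) * (T : ℝ) ^ 2 ≤ θ ^ 2 / 2 * (T : ℝ) ^ 2 :=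
      mul_le_mul_of_nonneg_right (by linarith) (sq_nonneg _)
    have h3 : θ ^ 2 / 2 * (T : ℝ) ^ 2 = (θ * T) ^ 2 / 2 := by ring
    rw [h3, hθ] at h2
    have h4 := Real.pi_le_four
    nlinarith
  have hE0 : 0 ≤ 1 - Real.cos θ := by linarith [Real.cos_le_one θ]
  refine ⟨by nlinarith, ?_, ?_⟩
  · intro t ht
    have h1 : (t : ℝ) ≤ c * n := le_trans (by exact_mod_cast ht) hH.init_time
    have h2 : ((t : ℝ) + 1 / 2) * θ ≤ Real.pi / 3 := by
      have h3 : ((t : ℝ) + 1 / 2) * 3 ≤ 2 * T := by nlinarith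
      have h4 := mul_le_mul_of_nonneg_right h3 hθ0.le
      have h5 : 2 * (T : ℝ) * θ = Real.pi := by linarith
      linarith
    unfold PathChain.wave
    have h6 := Real.cos_le_cos_of_nonneg_of_le_pi (by positivity) (by linarith) h2
    rwa [Real.cos_pi_div_three] at h6
  · have hfl : (⌊b * n⌋₊ : ℝ) ≤ b * n := Nat.floor_le (by positivity)
    have h1 : 6 * ((⌊b * n⌋₊ : ℝ) + 1) ≤ T := by nlinarith
    have h2 : (6 * ((⌊b * n⌋₊ : ℝ) + 1)) ^ 2 ≤ (T : ℝ) ^ 2 :=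
      pow_le_pow_left₀ (by positivity) h1 2
    have h3 := mul_le_mul_of_nonneg_right h2 hE0
    nlinarith

/-- If every correctly initialised input is rejected with probability at least `1 - ε²`, the energy
is at least `1 - cos (π / (2T)) - ε`. -/
lemma IsStandardClock.quadForm_ge {a b c : ℝ} {T Tinit : ℕ} (hb : 0 < b)
    (hH : H.IsStandardClock a b c T Tinit) (hn1 : 1 ≤ n) (hnb : 6 * (b + 1) ≤ a * n)
    (hnc : 2 * (c + 1) ≤ a * n) {ε : ℝ} (hε : 0 < ε)
    (hrej : ∀ γ, H.IsRun T γ → ∀ φ : Comp n Q → ℂ, (∀ t < T, H.inOp (γ t) *ᵥ φ = 0) →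
      (1 - ε ^ 2) * sqNorm φ ≤ H.rejectProb T γ φ) (v : (Fin n → Fin C × Fin Q) → ℂ) :
    (1 - Real.cos (Real.pi / (2 * T)) - ε) * sqNorm v ≤ quadForm H.hamiltonian v := by
  classical
  rcases lt_or_ge (1 - Real.cos (Real.pi / (2 * T))) ε with hlt | hεE
  · exact (mul_nonpos_of_nonpos_of_nonneg (by linarith) (sqNorm_nonneg v)).trans
      (H.quadForm_hamiltonian_nonneg v)
  obtain ⟨W, hD⟩ := hH.exists_isDeterministicOn
  obtain ⟨hE, hinit, hM⟩ := hH.asymptotics hb hn1 hnb hnc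
  set E₀ := 1 - Real.cos (Real.pi / (2 * T)) with hE₀
  have hE0 : 0 ≤ E₀ := by linarith [Real.cos_le_one (Real.pi / (2 * T))]
  rw [quadForm_hamiltonian, sqNorm_eq_sum_block,
    ← Finset.sum_filter_add_sum_filter_not Finset.univ (· ∈ H.runStates T),
    ← Finset.sum_filter_add_sum_filter_not Finset.univ (· ∈ H.runStates T) (H.stateEnergy v),
    mul_add]
  refine add_le_add ?_ ?_
  · have := sum_runStates_nonneg hD (T := T)
      (fun s => H.stateEnergy v s - (E₀ - ε) * sqNorm (block v s)) fun γ hγ => by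
        have := hγ.sum_stateEnergy_ge hD hH hε hεE hE hinit (hrej γ hγ) v
        rw [Finset.sum_sub_distrib, ← Finset.mul_sum]
        linarith
    rw [Finset.sum_sub_distrib, ← Finset.mul_sum] at this
    linarith
  · have h1 := sum_rest_sqNorm_le hD hH v
    set X := ∑ s ∈ Finset.univ.filter (· ∉ H.runStates T), H.stateEnergy v s
    have hX : 0 ≤ X := Finset.sum_nonneg fun s _ => H.stateEnergy_nonneg v s
    set Y := ∑ s ∈ Finset.univ.filter (· ∉ H.runStates T), sqNorm (block v s)
    have hY : 0 ≤ Y := Finset.sum_nonneg fun s _ => sqNorm_nonneg _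
    have h2 := mul_le_mul_of_nonneg_left h1 hE0
    have h3 := mul_le_mul_of_nonneg_right hM hX
    nlinarith

/-- The bounds on the ground state energy, for an amplified verification procedure that is given by
its rejection probabilities. -/
lemma IsStandardClock.groundEnergy_bounds {a b c : ℝ} {T Tinit : ℕ} (hb : 0 < b)
    (hH : H.IsStandardClock a b c T Tinit) {ι : Type} [Fintype ι] [DecidableEq ι]
    [Nonempty ι] {rej : (ι → ℂ) → ℝ} (henc : H.Encodes T rej) (q : ℝ)
    (hle : ∀ ψ, rej ψ ≤ sqNorm ψ) {yes no : Prop}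
    (hyes : yes → ∃ ψ, sqNorm ψ = 1 ∧ rej ψ ≤ Real.exp (-(2 * q)))
    (hno : no → ∀ ψ, (1 - Real.exp (-(2 * q))) * sqNorm ψ ≤ rej ψ) :
    ∃ E : ℝ, IsGroundEnergy H.hamiltonian E ∧ (yes → 0 ≤ E ∧ E ≤ Real.exp (-q)) ∧
      (no → (1 ≤ n ∧ 6 * (b + 1) ≤ a * n ∧ 2 * (c + 1) ≤ a * n →
        1 - Real.cos (Real.pi / (2 * T)) - Real.exp (-q) ≤ E) ∧
        E ≤ 1 - Real.cos (Real.pi / (2 * T))) := by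
  classical
  obtain ⟨W, hD⟩ := hH.exists_isDeterministicOn
  obtain ⟨γ, hγ⟩ := hH.exists_run
  have hT := hγ.pos
  -- a witness `ψ` is fed to the computation together with a fixed state of the unused registers
  have hinput : ∀ ψ : ι → ℂ, sqNorm ψ = 1 → rej 0 = 0 → ∃ φ : Comp n Q → ℂ, sqNorm φ = 1 ∧
      (∀ t < T, H.inOp (γ t) *ᵥ φ = 0) ∧ H.rejectProb T γ φ = rej ψ := by
    intro ψ hψ hrej0
    obtain ⟨m, J, hm, hJ, hker, hrejJ⟩ := henc γ hγ
    let y₀ : Fin m := ⟨0, hm⟩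
    let Ψ : ι × Fin m → ℂ := fun p => if p.2 = y₀ then ψ p.1 else 0
    refine ⟨J *ᵥ Ψ, ?_, (hker _).mpr ⟨Ψ, rfl⟩, ?_⟩
    · rw [sqNorm_mulVec_of_isometry hJ, ← hψ, sqNorm, Fintype.sum_prod_type]
      refine Finset.sum_congr rfl fun w _ => ?_
      rw [Finset.sum_eq_single y₀]
      · simp [Ψ]
      · intro y _ hy; simp [Ψ, hy]
      · simp
    · rw [hrejJ, Finset.sum_eq_single y₀]
      · simp [Ψ]
      · intro y _ hy
        have : (fun w => Ψ (w, y)) = 0 := by funext w; simp [Ψ, hy]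
        rw [this, hrej0]
      · simp
  have hunit : ∃ ψ : ι → ℂ, sqNorm ψ = 1 := by
    obtain ⟨i⟩ := ‹Nonempty ι›
    refine ⟨Pi.single i 1, ?_⟩
    rw [sqNorm, Finset.sum_eq_single i]
    · simp
    · intro j _ hj; simp [hj]
    · simp
  -- the rejection probability of the zero vector vanishes
  have hrej0 : rej 0 = 0 := by
    obtain ⟨m, J, hm, hJ, hker, hrejJ⟩ := henc γ hγ
    have h1 := hrejJ 0
    have h2 : H.rejectProb T γ (J *ᵥ 0) = 0 := by
      simp [rejectProb]
    rw [h2] at h1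
    have h3 : ∑ _y : Fin m, rej (fun w => (0 : ι × Fin m → ℂ) (w, _y)) = m * rej 0 := by
      have : ∀ y : Fin m, (fun w => (0 : ι × Fin m → ℂ) (w, y)) = 0 := fun y => rfl
      simp only [this, Finset.sum_const, Finset.card_univ, Fintype.card_fin, nsmul_eq_mul]
    rw [h3] at h1
    have hm' : (m : ℝ) ≠ 0 := by exact_mod_cast hm.ne'
    exact (mul_eq_zero.mp h1.symm).resolve_left hm'
  obtain ⟨ψ₀, hψ₀⟩ := hunit
  -- an input of norm one can only exist if the local dimensions are positive
  have hne : Nonempty (Fin n → Fin C × Fin Q) := by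
    obtain ⟨φ, hφ, -⟩ := hinput ψ₀ hψ₀ hrej0
    have : φ ≠ 0 := by rintro rfl; simp at hφ
    obtain ⟨q, -⟩ := Function.ne_iff.mp this
    exact ⟨fun i => (γ 0 i, q i)⟩
  obtain ⟨E, hgE, hEle, hEge⟩ :=
    exists_isGroundEnergy H.isHermitian_hamiltonian H.quadForm_hamiltonian_nonneg
  refine ⟨E, hgE, fun hy => ?_, fun hn => ⟨?_, ?_⟩⟩
  · have hE0 : 0 ≤ E := hEge 0 fun v => by
      rw [zero_mul]; exact H.quadForm_hamiltonian_nonneg v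
    refine ⟨hE0, ?_⟩
    obtain ⟨ψ, hψ, hrej⟩ := hyes hy
    obtain ⟨φ, hφ, hin, hrejφ⟩ := hinput ψ hψ hrej0
    -- the history state with equal amplitudes
    obtain ⟨v, hv, hqv⟩ := hγ.exists_history hD hH (fun _ => 1) φ hin
    have h1 := hEle v
    rw [hv, hqv, hφ, hrejφ] at h1
    simp only [PathChain.hop, sub_self, norm_zero, norm_one, one_pow, Finset.sum_const,
      Finset.card_range, nsmul_eq_mul, mul_one, one_mul, ne_eq, OfNat.ofNat_ne_zero,
      not_false_eq_true, zero_pow, mul_zero, zero_add] at h1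
    have h2 : (1 : ℝ) ≤ T := by exact_mod_cast hT
    have h3 : E ≤ rej ψ := by nlinarith
    have h4 := hle ψ
    rw [hψ] at h4
    -- for `q ≤ 0` the bound `e^{-2q}` is of no use, but `rej ψ ≤ 1` is enough
    rcases le_total q 0 with hq | hq
    · exact h3.trans (h4.trans (Real.one_le_exp (by linarith)))
    · exact h3.trans (hrej.trans (Real.exp_le_exp.mpr (by linarith)))
  · -- soundness has to be used on every legal evolution, not only on `γ`
    rintro ⟨hn1, hnb, hnc⟩
    refine hEge _ (hH.quadForm_ge hb hn1 hnb hnc (Real.exp_pos _) ?_)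
    intro γ hγ φ hφ
    obtain ⟨m, J, hm, hJ, hker, hrejJ⟩ := henc γ hγ
    obtain ⟨Ψ, rfl⟩ := (hker φ).mp hφ
    have hexp : Real.exp (-q) ^ 2 = Real.exp (-(2 * q)) := by
      rw [← Real.exp_nat_mul]; congr 1; push_cast; ring
    rw [hrejJ, sqNorm_mulVec_of_isometry hJ, hexp, sqNorm, Fintype.sum_prod_type_right,
      Finset.mul_sum]
    exact Finset.sum_le_sum fun y _ => hno hn fun w => Ψ (w, y)
  · -- the ground state of the path that is penalised at its last site, on an arbitrary input
    obtain ⟨φ, hφ, hin, hrejφ⟩ := hinput ψ₀ hψ₀ hrej0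
    obtain ⟨v, hv, hqv⟩ := hγ.exists_history hD hH
      (fun t => (PathChain.wave (Real.pi / (2 * T)) t : ℂ)) φ hin
    have h1 := hEle v
    rw [hv, hqv, hφ, hrejφ] at h1
    simp only [Complex.norm_real, Real.norm_eq_abs, sq_abs, mul_one] at h1
    have h2 := PathChain.energy_wave hT
    have h3 : ((T - 1 : ℕ) : ℝ) = (T : ℝ) - 1 := by rw [Nat.cast_sub hT]; simp
    rw [h3] at h1
    have h4 := hle ψ₀
    rw [hψ₀] at h4
    have h5 := mul_le_mul_of_nonneg_left h4
      (sq_nonneg (PathChain.wave (Real.pi / (2 * T)) ((T : ℝ) - 1)))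
    have hpos : 0 < ∑ t ∈ Finset.range T, PathChain.wave (Real.pi / (2 * T)) t ^ 2 :=
      Finset.sum_pos (fun t ht => pow_pos (PathChain.wave_pos hT (Finset.mem_range.mp ht)) 2)
        ⟨0, Finset.mem_range.mpr hT⟩
    refine le_of_mul_le_mul_right ?_ hpos
    linarith

end StandardForm

theorem mainTheorem1 :
    ∃ K : ℝ, 0 < K ∧ ∀ a b c : ℝ, 0 < a → 0 < b → 0 < c → ∃ n₀ : ℕ,
      ∀ (yes no : Set (List Bool)) (V : List Bool → Verifier) (p : ℕ → ℝ) (x : List Bool)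
        (n C Q T Tinit : ℕ) (H : StandardForm n C Q), H.IsStandardClock a b c T Tinit →
        -- amplification by `k`-fold repetition of a QMA verification
        (∀ k : ℕ, IsQMAVerifier V yes no (fun _ => 1 / 3) → K * p n ≤ k →
          H.Encodes T ((V x).rejectProbPow k) →
          ∃ E : ℝ, IsGroundEnergy H.hamiltonian E ∧
            (x ∈ yes → 0 ≤ E ∧ E ≤ Real.exp (-p n)) ∧
            (x ∈ no →
              (n₀ ≤ n → 1 - Real.cos (Real.pi / (2 * T)) - Real.exp (-p n) ≤ E) ∧
              E ≤ 1 - Real.cos (Real.pi / (2 * T)))) ∧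
        -- any other amplified verification
        (∀ δ : List Bool → ℝ, IsQMAVerifier V yes no δ → δ x ≤ Real.exp (-(2 * p n)) →
          H.Encodes T (V x).rejectProb →
          ∃ E : ℝ, IsGroundEnergy H.hamiltonian E ∧
            (x ∈ yes → 0 ≤ E ∧ E ≤ Real.exp (-p n)) ∧
            (x ∈ no →
              (n₀ ≤ n → 1 - Real.cos (Real.pi / (2 * T)) - Real.exp (-p n) ≤ E) ∧
              E ≤ 1 - Real.cos (Real.pi / (2 * T)))) := by
  -- the per-copy base of the exponential moment bound is `(4/3) / √2 = (8/9)^{1/2}`, and the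
  -- error must not exceed `e^{-2p}`
  refine ⟨4 / Real.log (9 / 8), div_pos (by norm_num) (Real.log_pos (by norm_num)), ?_⟩
  intro a b c ha hb _
  refine ⟨max 1 (max ⌈6 * (b + 1) / a⌉₊ ⌈2 * (c + 1) / a⌉₊), ?_⟩
  intro yes no V p x n C Q T Tinit H hH
  have hlarge : max 1 (max ⌈6 * (b + 1) / a⌉₊ ⌈2 * (c + 1) / a⌉₊) ≤ n →
      1 ≤ n ∧ 6 * (b + 1) ≤ a * n ∧ 2 * (c + 1) ≤ a * n := by
    intro h
    rw [max_le_iff, max_le_iff, Nat.ceil_le, Nat.ceil_le, div_le_iff₀ ha, div_le_iff₀ ha] at h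
    exact ⟨h.1, by linarith [h.2.1], by linarith [h.2.2]⟩
  refine ⟨fun k hV hk henc => ?_, fun δ hV hδ henc => ?_⟩
  · have hyes : x ∈ yes → ∃ Ψ : (Fin k → (V x).Wit) → ℂ, sqNorm Ψ = 1 ∧
        (V x).rejectProbPow k Ψ ≤ Real.exp (-(2 * p n)) := by
      intro hx
      obtain ⟨ψ, hψ, hacc⟩ := hV.complete x hx
      refine ⟨fun w => ∏ j, ψ (w j), ?_, (V x).rejectProbPow_prod_le hk hψ hacc⟩
      rw [sqNorm_prod, hψ, one_pow]
    obtain ⟨E, hE, h1, h2⟩ := hH.groundEnergy_bounds hb henc (p n)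
      ((V x).rejectProbPow_le k) hyes
      fun hx Ψ => (V x).sub_exp_mul_le_rejectProbPow hk (hV.sound x hx) Ψ
    exact ⟨E, hE, h1, fun hx => ⟨fun hn => (h2 hx).1 (hlarge hn), (h2 hx).2⟩⟩
  · have hsum := (V x).acceptProb_add_rejectProb
    have hyes : x ∈ yes → ∃ ψ : (V x).Wit → ℂ, sqNorm ψ = 1 ∧
        (V x).rejectProb ψ ≤ Real.exp (-(2 * p n)) := by
      intro hx
      obtain ⟨ψ, hψ, hacc⟩ := hV.complete x hx
      exact ⟨ψ, hψ, by linarith [hsum ψ]⟩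
    have hno : x ∈ no → ∀ ψ, (1 - Real.exp (-(2 * p n))) * sqNorm ψ ≤ (V x).rejectProb ψ := by
      intro hx ψ
      have h3 := (V x).acceptProb_le_mul_sqNorm
        (fun ψ hψ => (hV.sound x hx ψ hψ).trans hδ) ψ
      linarith [hsum ψ]
    obtain ⟨E, hE, h1, h2⟩ := hH.groundEnergy_bounds hb henc (p n)
      (fun ψ => by linarith [hsum ψ, (V x).acceptProb_nonneg ψ]) hyes hno
    exact ⟨E, hE, h1, fun hx => ⟨fun hn => (h2 hx).1 (hlarge hn), (h2 hx).2⟩⟩
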